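/- **Setting.** Let $K$ be a field of characteristic zero. For a formal operator $P=\sum_{k\ge 0}a_k\partial^k$ with $a_k\in K[[x]]$ put $\mathbf{ord}(P)=\sup_k\{k-\upsilon(a_k)\}$, where $\upsilon$ is the $x$-adic valuation, and let $\hat D_1^{sym}$ be the ring of all such $P$ with $\mathbf{ord}(P)<\infty$ (with $\partial a=a\partial+a'$); it contains $D_1=K[[x]][\partial]$. The highest symbol $\sigma(P)$ is the sum of those terms $\alpha\,x^i\partial^k$ of $P$ with $k-i=\mathbf{ord}(P)$; $P$ is monic of order $r$ if $\mathbf{ord}(P)=r$ and $\sigma(P)=\partial^r$. Let $\int=\sum_{k\ge0}\frac{(-1)^k x^{k+1}}{(k+1)!}\partial^k$, and let $C(\partial^q)$ be the centraliser of $\partial^q$ in $\hat D_1^{sym}$. Let $Q,P\in D_1$ be commuting differential operators of positive orders $q=dm$ and $p=dn$, with $d,m,n\ge1$ and $\gcd(n,m)=1$; $Q$ is normalised, $Q=\partial^q+a_{q-2}\partial^{q-2}+\dots$, and $P$ has highest coefficient $1$. A *normal form* of $P$ with respect to $Q$ is an operator $P'=\hat SP\hat S^{-1}$ with $\hat S\in\hat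 D_1^{sym}$ invertible, monic of order $0$, and $\hat SQ\hat S^{-1}=\partial^q$. Let $\tilde K\supseteq K$ be a field extension containing a primitive $q$-th root of unity $\xi$, and let $A_i=\sum_k\frac{(\xi^i-1)^kx^k}{k!}\partial^k$ for $0\le i<q$. Put $\Phi(\sum_{i}f_iA_i)=(\sum_i f_i\xi^{ij})_{j\in\mathbb Z/q}\in\tilde K^{\oplus q}$ for $f_i\in\tilde K$. Every element of $C(\partial^q)$ is, over $\tilde K$, a finite sum $\sum_l b_lD^l$ with $b_l=\sum_i f_{l,i}A_i$, where $D^l=\partial^l$ for $l\ge0$ and $D^l=\int^{-l}$ for $l<0$; its image under $\hat\Phi$ is the Laurent polynomial $\sum_l\Phi(b_l)\tilde D^l$ with coefficients in $\tilde K^{\oplus q}$. For $1\le i\le q-1$ and $0\le\alpha\le d-1$ let $N_{i,\alpha}=\{j\ge1 : \alpha+d\,(jn \bmod m)\ge\max\{i,d\}\}$. Call $P'\in C(\partial^q)$ *partially normalised* if $$\hat\Phi(P')=\tilde D^p+\sum_{l=-q+1}^{p-1}p_l\tilde D^l,\qquad p_l=(p_{l,0},\dots,p_{l,q-1})\in\tilde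 K^{\oplus q},$$ and, with the second index of $p_{l,j}$ read modulo $q$ and $\alpha$ running over $0,\dots,d-1$: * if $p\ge q$: $p_{l,\alpha+(j-1)p}=0$ for $j\in N_{p-l,\alpha}$ when $p-q<l<p$; and $p_{l,j}=0$ for $j=0,\dots,-l-1$ when $-q<l<0$; * if $p<q$: $p_{l,\alpha+(j-1)p}=0$ for $j\in N_{p-l,\alpha}$ when $0\le l<p$; $p_{l,j}=0$ if $j\in\{0,\dots,-l-1\}$ or $j=\alpha+(k-1)p$ with $k\in N_{p-l,\alpha}$, when $p-q<l<0$; and $p_{l,j}=0$ for $j=0,\dots,-l-1$ when $-q<l\le p-q$. The remaining coefficients $p_{l,j}$, $-q<l<p$, are the *coordinates* of $P'$. **Lemma 3.1.** 1. $P$ has a partially normalised normal form $P'$ with respect to $Q$. 2. If $P'$ and $P''$ are two partially normalised operators with different values of the coordinates, then there is no invertible monic operator of order zero $S\in C(\partial^q)$, $S=1+\sum_{l=1}^{q-1}s_l\int^l$ with each $s_l$ a $\tilde K$-linear combination of the $A_i$ and $\Phi(s_l)_\alpha=0$ for $\alpha=0,\dots,d-1$ and all $l$, such that $P'=S^{-1}P''S$.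 3. If $P'$ is partially normalised, then there is no invertible operator $S\ne1$ as in 2 such that $P'=S^{-1}P'S$. -/

import Mathlib

open scoped PowerSeries

/-! ### The complete ring of operators `D̂₁^sym` -/

namespace NormalForms

section Raw

variable {K : Type*} [Field K]

/-- `OrdLE a d` says that the formal operator `∑ₖ aₖ ∂ᵏ` has order at most `d`,
i.e. `sup {k - υ(aₖ)} ≤ d`, where `υ` is the `x`-adic valuation of `K[[x]]`. -/
def OrdLE (a : ℕ → K⟦X⟧) (d : ℤ) : Prop :=
  ∀ k i : ℕ, PowerSeries.coeff i (a k) ≠ 0 → (k : ℤ) - i ≤ d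

/-- The coefficients of `∂ ∘ ∑ₖ bₖ ∂ᵏ`, computed with the rule `∂ b = b ∂ + b'`. -/
noncomputable def leftD (b : ℕ → K⟦X⟧) : ℕ → K⟦X⟧ := fun k =>
  PowerSeries.derivative K (b k) + (if k = 0 then 0 else b (k - 1))

/-- The coefficients of the product `(∑ᵢ aᵢ ∂ⁱ)(∑ⱼ bⱼ ∂ʲ) = ∑ᵢ aᵢ (∂ⁱ ∑ⱼ bⱼ ∂ʲ)`. For operators of
finite order each coefficient of `xᴺ` receives only finitely many contributions. -/
noncomputable def rawMul (a b : ℕ → K⟦X⟧) : ℕ → K⟦X⟧ := fun k =>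
  PowerSeries.mk fun N => ∑ᶠ i : ℕ, PowerSeries.coeff N (a i * (leftD^[i] b) k)

/-- The action of the operator `∑ₖ aₖ ∂ᵏ` on power series, `f ↦ ∑ₖ aₖ f⁽ᵏ⁾`. -/
noncomputable def rawAct (a : ℕ → K⟦X⟧) (f : K⟦X⟧) : K⟦X⟧ :=
  PowerSeries.mk fun N =>
    ∑ᶠ k : ℕ, PowerSeries.coeff N (a k * ((PowerSeries.derivative K)^[k] f))

theorem OrdLE.coeff_eq_zero {a : ℕ → K⟦X⟧} {d : ℤ} (h : OrdLE a d) {k i : ℕ}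
    (hk : d < (k : ℤ) - i) : PowerSeries.coeff i (a k) = 0 := by
  by_contra hne
  exact absurd (h k i hne) (not_le.mpr hk)

theorem OrdLE.mono {a : ℕ → K⟦X⟧} {d e : ℤ} (h : OrdLE a d) (hde : d ≤ e) : OrdLE a e :=
  fun k i hne => (h k i hne).trans hde

theorem OrdLE.coeff_mul_eq_zero {a : ℕ → K⟦X⟧} {d : ℤ} (h : OrdLE a d) {k N : ℕ}
    (hk : d < (k : ℤ) - N) (g : K⟦X⟧) : PowerSeries.coeff N (a k * g) = 0 := by
  rw [PowerSeries.coeff_mul]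
  refine Finset.sum_eq_zero fun p hp => ?_
  have := Finset.HasAntidiagonal.mem_antidiagonal.mp hp
  rw [h.coeff_eq_zero (by omega), zero_mul]

theorem OrdLE.leftD {b : ℕ → K⟦X⟧} {d : ℤ} (h : OrdLE b d) : OrdLE (leftD b) (d + 1) := by
  intro k i hne
  by_contra hlt
  apply hne
  unfold NormalForms.leftD
  rw [map_add, PowerSeries.coeff_derivative, h.coeff_eq_zero (by push_cast; omega)]
  split_ifs with hk
  · simp
  · rw [h.coeff_eq_zero (by omega)]; simp

theorem OrdLE.iterate_leftD {b : ℕ → K⟦X⟧} {d : ℤ} (h : OrdLE b d) (n : ℕ) :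
    OrdLE (NormalForms.leftD^[n] b) (d + n) := by
  induction n with
  | zero => simpa using h
  | succ n ih =>
    rw [Function.iterate_succ_apply']
    exact ih.leftD.mono (by push_cast; omega)

theorem coeff_mul_congr {f f' g : K⟦X⟧} {N : ℕ}
    (h : ∀ u ≤ N, PowerSeries.coeff u f = PowerSeries.coeff u f') :
    PowerSeries.coeff N (f * g) = PowerSeries.coeff N (f' * g) := by
  rw [PowerSeries.coeff_mul, PowerSeries.coeff_mul]
  refine Finset.sum_congr rfl fun p hp => ?_
  have := Finset.HasAntidiagonal.mem_antidiagonal.mp hp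
  rw [h _ (by omega)]

theorem coeff_rawMul {a : ℕ → K⟦X⟧} {d : ℤ} (h : OrdLE a d) (b : ℕ → K⟦X⟧) (k N M : ℕ)
    (hM : N + d < M) : PowerSeries.coeff N (rawMul a b k) =
      ∑ i ∈ Finset.range M, PowerSeries.coeff N (a i * (leftD^[i] b) k) := by
  unfold rawMul
  rw [PowerSeries.coeff_mk]
  refine finsum_eq_finsetSum_of_support_subset _ fun i hi => ?_
  by_contra hlt
  simp only [Finset.coe_range, Set.mem_Iio, not_lt] at hlt
  exact hi (h.coeff_mul_eq_zero (by omega) _)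

theorem coeff_rawAct {a : ℕ → K⟦X⟧} {d : ℤ} (h : OrdLE a d) (f : K⟦X⟧) (N M : ℕ)
    (hM : N + d < M) : PowerSeries.coeff N (rawAct a f) =
      ∑ k ∈ Finset.range M, PowerSeries.coeff N (a k * ((PowerSeries.derivative K)^[k] f)) := by
  unfold rawAct
  rw [PowerSeries.coeff_mk]
  refine finsum_eq_finsetSum_of_support_subset _ fun i hi => ?_
  by_contra hlt
  simp only [Finset.coe_range, Set.mem_Iio, not_lt] at hlt
  exact hi (h.coeff_mul_eq_zero (by omega) _)

theorem OrdLE.rawMul {a b : ℕ → K⟦X⟧} {d e : ℤ} (ha : OrdLE a d) (hb : OrdLE b e) :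
    OrdLE (rawMul a b) (d + e) := by
  intro k N hne
  by_contra hlt
  apply hne
  rw [coeff_rawMul ha b k N (N + d.toNat + 1) (by have := Int.self_le_toNat d; push_cast; omega)]
  refine Finset.sum_eq_zero fun i _ => ?_
  rw [PowerSeries.coeff_mul]
  refine Finset.sum_eq_zero fun p hp => ?_
  have := Finset.HasAntidiagonal.mem_antidiagonal.mp hp
  by_cases h1 : d < (i : ℤ) - p.1
  · rw [ha.coeff_eq_zero h1, zero_mul]
  · rw [(hb.iterate_leftD i).coeff_eq_zero (by omega), mul_zero]

theorem rawAct_leftD {b : ℕ → K⟦X⟧} {d : ℤ} (h : OrdLE b d) (f : K⟦X⟧) :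
    rawAct (leftD b) f = PowerSeries.derivative K (rawAct b f) := by
  ext N
  set M : ℕ := N + d.toNat + 2 with hMdef
  have hd := Int.self_le_toNat d
  rw [coeff_rawAct h.leftD f N (M + 1) (by push_cast [hMdef]; omega),
    PowerSeries.coeff_derivative, coeff_rawAct h f (N + 1) M (by push_cast [hMdef]; omega)]
  have hlast : PowerSeries.coeff N
      (PowerSeries.derivative K (b M) * ((PowerSeries.derivative K)^[M] f)) = 0 := by
    have h' : OrdLE (fun k => PowerSeries.derivative K (b k)) (d + 1) := by
      intro k i hne
      rw [PowerSeries.coeff_derivative] at hne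
      have := h k (i + 1) (left_ne_zero_of_mul hne)
      push_cast at this
      omega
    exact h'.coeff_mul_eq_zero (k := M) (by push_cast [hMdef]; omega) _
  have hL : ∀ k, leftD b k * ((PowerSeries.derivative K)^[k] f) =
      PowerSeries.derivative K (b k) * ((PowerSeries.derivative K)^[k] f) +
        (if k = 0 then 0 else b (k - 1)) * ((PowerSeries.derivative K)^[k] f) :=
    fun k => add_mul _ _ _
  simp only [hL, map_add, Finset.sum_add_distrib]
  rw [Finset.sum_range_succ, hlast, add_zero, Finset.sum_range_succ' (fun k =>
    PowerSeries.coeff N ((if k = 0 then 0 else b (k - 1)) * ((PowerSeries.derivative K)^[k] f)))]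
  simp only [if_true, zero_mul, map_zero, add_zero, Nat.succ_ne_zero, if_false,
    Nat.add_sub_cancel]
  rw [← Finset.sum_add_distrib, Finset.sum_mul]
  refine Finset.sum_congr rfl fun k _ => ?_
  rw [← PowerSeries.coeff_derivative, Derivation.leibniz, smul_eq_mul, smul_eq_mul, map_add,
    Function.iterate_succ_apply', mul_comm (PowerSeries.derivative K (b k)), add_comm]

theorem rawAct_iterate_leftD {b : ℕ → K⟦X⟧} {d : ℤ} (h : OrdLE b d) (f : K⟦X⟧) (n : ℕ) :
    rawAct (leftD^[n] b) f = (PowerSeries.derivative K)^[n] (rawAct b f) := by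
  induction n with
  | zero => rfl
  | succ n ih =>
    rw [Function.iterate_succ_apply', Function.iterate_succ_apply', ← ih,
      rawAct_leftD (h.iterate_leftD n)]

/-- The product of operators is the composition of their actions on `K[[x]]`. -/
theorem rawAct_rawMul {a b : ℕ → K⟦X⟧} {d e : ℤ} (ha : OrdLE a d) (hb : OrdLE b e) (f : K⟦X⟧) :
    rawAct (rawMul a b) f = rawAct a (rawAct b f) := by
  ext N
  have hd := Int.self_le_toNat d
  have he := Int.self_le_toNat e
  set I : ℕ := N + d.toNat + 1 with hI
  set M : ℕ := N + d.toNat + e.toNat + I + 1 with hM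
  rw [coeff_rawAct (ha.rawMul hb) f N M (by push_cast [hM]; omega),
    coeff_rawAct ha (rawAct b f) N I (by push_cast [hI]; omega)]
  have h1 : ∀ k, PowerSeries.coeff N (rawMul a b k * ((PowerSeries.derivative K)^[k] f)) =
      ∑ i ∈ Finset.range I, PowerSeries.coeff N
        (a i * (leftD^[i] b) k * ((PowerSeries.derivative K)^[k] f)) := by
    intro k
    rw [← map_sum, ← Finset.sum_mul]
    refine coeff_mul_congr fun u hu => ?_
    rw [coeff_rawMul ha b k u I (by push_cast [hI]; omega), map_sum]
  simp only [h1]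
  rw [Finset.sum_comm]
  refine Finset.sum_congr rfl fun i hi => ?_
  rw [Finset.mem_range] at hi
  rw [← rawAct_iterate_leftD hb, ← map_sum, mul_comm (a i)]
  simp only [mul_assoc]
  rw [← Finset.mul_sum, mul_comm (a i)]
  refine (coeff_mul_congr fun u hu => ?_).symm
  rw [coeff_rawAct (hb.iterate_leftD i) f u M (by push_cast [hM]; omega), map_sum]

theorem rawAct_injective [CharZero K] {a b : ℕ → K⟦X⟧} {d e : ℤ} (ha : OrdLE a d)
    (hb : OrdLE b e) (h : ∀ f, rawAct a f = rawAct b f) : a = b := by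
  have key : ∀ n : ℕ, (PowerSeries.derivative K)^[n] (PowerSeries.X ^ n : K⟦X⟧) =
      PowerSeries.C (n.factorial : K) := by
    intro n
    ext j
    rw [PowerSeries.coeff_iterate_derivative, PowerSeries.coeff_C, PowerSeries.coeff_X_pow]
    by_cases hj : j = 0
    · subst hj; simp [Nat.ascFactorial_eq_div]
    · simp [hj]
  have key0 : ∀ n k : ℕ, n < k → (PowerSeries.derivative K)^[k] (PowerSeries.X ^ n : K⟦X⟧) = 0 := by
    intro n k hnk
    ext j
    rw [PowerSeries.coeff_iterate_derivative, PowerSeries.coeff_X_pow,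
      if_neg (by omega)]
    simp
  have expand : ∀ (c : ℕ → K⟦X⟧) (d : ℤ), OrdLE c d → ∀ n : ℕ,
      rawAct c (PowerSeries.X ^ n) = (∑ k ∈ Finset.range n,
        c k * ((PowerSeries.derivative K)^[k] (PowerSeries.X ^ n))) +
          c n * PowerSeries.C (n.factorial : K) := by
    intro c d hc n
    ext N
    have hd := Int.self_le_toNat d
    rw [coeff_rawAct hc _ N (n + 1 + (N + d.toNat)) (by push_cast; omega), ← key n,
      ← Finset.sum_range_succ (fun k =>
        c k * ((PowerSeries.derivative K)^[k] (PowerSeries.X ^ n))), map_sum]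
    symm
    refine Finset.sum_subset (fun x hx => ?_) fun k _ hk => ?_
    · rw [Finset.mem_range] at *; omega
    · rw [Finset.mem_range] at hk
      rw [key0 n k (by omega)]; simp
  funext n
  induction n using Nat.strong_induction_on with
  | _ n ih =>
    have h0 := h (PowerSeries.X ^ n)
    rw [expand a d ha, expand b e hb, Finset.sum_congr rfl fun k hk => by
      rw [ih k (Finset.mem_range.mp hk)]] at h0
    have h1 := add_left_cancel h0
    refine mul_right_cancel₀ ?_ h1
    intro hC
    have h2 := congrArg PowerSeries.constantCoeff hC
    rw [PowerSeries.constantCoeff_C, map_zero] at h2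
    exact Nat.cast_ne_zero.mpr n.factorial_ne_zero h2

end Raw

/-- The space of formal operators `∑ₖ aₖ ∂ᵏ`, `aₖ ∈ K[[x]]`, of finite order. -/
def opSubmodule (K : Type*) [Field K] : Submodule K (ℕ → K⟦X⟧) where
  carrier := {a | ∃ d : ℤ, OrdLE a d}
  zero_mem' := ⟨0, fun k i h => absurd (by simp) h⟩
  add_mem' := by
    rintro a b ⟨d, hd⟩ ⟨e, he⟩
    refine ⟨max d e, fun k i h => ?_⟩
    by_contra hlt
    apply h
    rw [Pi.add_apply, map_add, hd.coeff_eq_zero (by omega), he.coeff_eq_zero (by omega), add_zero]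
  smul_mem' := by
    rintro c a ⟨d, hd⟩
    refine ⟨d, fun k i h => hd k i fun h0 => h ?_⟩
    rw [Pi.smul_apply, map_smul, h0, smul_zero]

/-- The ring `D̂₁^sym` over `K`. -/
def DSym (K : Type*) [Field K] : Type _ := opSubmodule K

namespace DSym

section Basic

variable {K : Type*} [Field K]

noncomputable instance : AddCommGroup (DSym K) := inferInstanceAs (AddCommGroup (opSubmodule K))

noncomputable instance : Module K (DSym K) := inferInstanceAs (Module K (opSubmodule K))

/-- The coefficient `aₖ ∈ K[[x]]` at `∂ᵏ` of an operator. -/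
def cf (P : DSym K) : ℕ → K⟦X⟧ := P.1

theorem ext {P Q : DSym K} (h : P.cf = Q.cf) : P = Q := Subtype.ext h

theorem exists_ordLE (P : DSym K) : ∃ d : ℤ, OrdLE P.cf d := P.2

theorem cf_add (P Q : DSym K) : (P + Q).cf = P.cf + Q.cf := rfl

noncomputable instance : Mul (DSym K) where
  mul P Q := ⟨rawMul P.cf Q.cf, by
    obtain ⟨d, hd⟩ := P.exists_ordLE
    obtain ⟨e, he⟩ := Q.exists_ordLE
    exact ⟨d + e, hd.rawMul he⟩⟩

noncomputable instance : One (DSym K) where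
  one := ⟨fun k => if k = 0 then 1 else 0, 0, fun k i h => by
    by_cases hk : k = 0
    · subst hk; simp
    · simp [hk] at h⟩

/-- The action of an operator on power series. -/
noncomputable def act (P : DSym K) (f : K⟦X⟧) : K⟦X⟧ := rawAct P.cf f

theorem act_mul (P Q : DSym K) (f : K⟦X⟧) : (P * Q).act f = P.act (Q.act f) := by
  obtain ⟨d, hd⟩ := P.exists_ordLE
  obtain ⟨e, he⟩ := Q.exists_ordLE
  exact rawAct_rawMul hd he f

theorem act_one (f : K⟦X⟧) : (1 : DSym K).act f = f := by
  have h1 : (1 : DSym K).cf = fun k => if k = 0 then 1 else 0 := rfl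
  ext N
  unfold act rawAct
  rw [PowerSeries.coeff_mk, finsum_eq_single _ 0 fun k hk => by simp [h1, hk]]
  simp [h1]

theorem coeff_act_eq (P : DSym K) : ∃ d : ℕ, ∀ (f : K⟦X⟧) (N M : ℕ), N + d < M →
    PowerSeries.coeff N (P.act f) = ∑ k ∈ Finset.range M,
      PowerSeries.coeff N (P.cf k * ((PowerSeries.derivative K)^[k] f)) := by
  obtain ⟨d, hd⟩ := P.exists_ordLE
  have := Int.self_le_toNat d
  exact ⟨d.toNat, fun f N M hM => coeff_rawAct hd f N M (by omega)⟩

theorem act_add (P Q : DSym K) (f : K⟦X⟧) : (P + Q).act f = P.act f + Q.act f := by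
  ext N
  obtain ⟨d, hd⟩ := P.coeff_act_eq
  obtain ⟨e, he⟩ := Q.coeff_act_eq
  obtain ⟨c, hc⟩ := (P + Q).coeff_act_eq
  have h1 : N + c < N + c + d + e + 1 := by omega
  have h2 : N + d < N + c + d + e + 1 := by omega
  have h3 : N + e < N + c + d + e + 1 := by omega
  rw [map_add, hc f N _ h1, hd f N _ h2, he f N _ h3, ← Finset.sum_add_distrib]
  refine Finset.sum_congr rfl fun k _ => ?_
  rw [cf_add, Pi.add_apply, add_mul, map_add]

theorem act_map_add (P : DSym K) (f g : K⟦X⟧) : P.act (f + g) = P.act f + P.act g := by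
  ext N
  obtain ⟨d, hd⟩ := P.coeff_act_eq
  have h1 : N + d < N + d + 1 := by omega
  rw [map_add, hd _ N _ h1, hd f N _ h1, hd g N _ h1, ← Finset.sum_add_distrib]
  refine Finset.sum_congr rfl fun k _ => ?_
  rw [iterate_map_add, mul_add, map_add]

theorem act_injective [CharZero K] {P Q : DSym K} (h : ∀ f, P.act f = Q.act f) : P = Q := by
  obtain ⟨d, hd⟩ := P.exists_ordLE
  obtain ⟨e, he⟩ := Q.exists_ordLE
  exact ext (rawAct_injective hd he h)

end Basic

section Ring

variable {K : Type*} [Field K] [CharZero K]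

noncomputable instance : Ring (DSym K) :=
  { (inferInstance : AddCommGroup (DSym K)), (inferInstance : Mul (DSym K)),
    (inferInstance : One (DSym K)) with
    left_distrib := fun P Q R => act_injective fun f => by
      simp only [act_mul, act_add, act_map_add]
    right_distrib := fun P Q R => act_injective fun f => by
      simp only [act_mul, act_add]
    zero_mul := fun P => by
      have h : ∀ f, (0 : DSym K).act f = 0 := fun f => by
        have := act_add (0 : DSym K) 0 f
        rwa [add_zero, left_eq_add] at this
      exact act_injective fun f => by rw [act_mul, h, h]
    mul_zero := fun P => by
      have h : ∀ f, (0 : DSym K).act f = 0 := fun f => by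
        have := act_add (0 : DSym K) 0 f
        rwa [add_zero, left_eq_add] at this
      have h' : P.act 0 = 0 := by
        have := act_map_add P 0 0
        rwa [add_zero, left_eq_add] at this
      exact act_injective fun f => by rw [act_mul, h, h']
    mul_assoc := fun P Q R => act_injective fun f => by simp only [act_mul]
    one_mul := fun P => act_injective fun f => by rw [act_mul, act_one]
    mul_one := fun P => act_injective fun f => by rw [act_mul, act_one]
    zsmul := fun n P => n • P
    zsmul_zero' := fun P => zero_smul ℤ P
    zsmul_succ' := fun n P => SubNegMonoid.zsmul_succ' n P
    zsmul_neg' := fun n P => SubNegMonoid.zsmul_neg' n P }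

end Ring

end DSym

/-! ### Standard operators, symbols and orders -/

section Operators

variable {K : Type*} [Field K]

/-- The operator `∂`. -/
noncomputable def del (K : Type*) [Field K] : DSym K :=
  ⟨fun k => if k = 1 then 1 else 0, 1, fun k i h => by
    by_cases hk : k = 1
    · subst hk; simp
    · simp [hk] at h⟩

/-- The normally ordered exponential `exp((c x) ∗ ∂) = ∑ₖ (c x)ᵏ / k! ∂ᵏ`. -/
noncomputable def expStar (c : K) : DSym K :=
  ⟨fun k => PowerSeries.monomial k (c ^ k * (k.factorial : K)⁻¹), 0, fun k i h => by
    rw [PowerSeries.coeff_monomial] at h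
    by_cases hk : i = k
    · subst hk; simp
    · simp [hk] at h⟩

/-- The operator `∫ = (1 - exp((-x) ∗ ∂)) ∂⁻¹ = ∑ₖ (-1)ᵏ xᵏ⁺¹ / (k+1)! ∂ᵏ`. -/
noncomputable def integ (K : Type*) [Field K] : DSym K :=
  ⟨fun k => PowerSeries.monomial (k + 1) ((-1) ^ k * ((k + 1).factorial : K)⁻¹), -1,
    fun k i h => by
      rw [PowerSeries.coeff_monomial] at h
      by_cases hk : i = k + 1
      · subst hk; push_cast; omega
      · simp [hk] at h⟩

/-- The operator `A_i = exp(((ξⁱ - 1) x) ∗ ∂)`. -/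
noncomputable def opA (ξ : K) (i : ℕ) : DSym K := expStar (ξ ^ i - 1)

/-- `D^r`, which is `∂^r` for `r ≥ 0` and `∫^(-r)` otherwise. -/
noncomputable def opD (K : Type*) [Field K] [CharZero K] (r : ℤ) : DSym K :=
  if 0 ≤ r then del K ^ r.toNat else integ K ^ (-r).toNat

/-- The homogeneous component `P_r = ∑_{k - i = r} α_{k,i} xⁱ ∂ᵏ` of `P = ∑ α_{k,i} xⁱ ∂ᵏ`. -/
noncomputable def homComp (P : DSym K) (r : ℤ) : DSym K :=
  ⟨fun k => PowerSeries.mk fun i => if (k : ℤ) - i = r then PowerSeries.coeff i (P.cf k) else 0,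
    r, fun k i h => by
      by_contra hlt
      apply h
      rw [PowerSeries.coeff_mk, if_neg (by omega)]⟩

/-- `P` is monic of order `r`: its highest symbol `σ(P)` is `∂^r`. -/
def IsMonic [CharZero K] (P : DSym K) (r : ℕ) : Prop :=
  OrdLE P.cf r ∧ homComp P r = del K ^ r

/-- `P ∈ D₁ = K[[x]][∂]` is a monic differential operator of order `r`. -/
def IsMonicDiffOp (P : DSym K) (r : ℕ) : Prop :=
  P.cf r = 1 ∧ ∀ k, r < k → P.cf k = 0

/-- `P ∈ D₁` is a normalised differential operator of positive order `r`,
`P = ∂^r + a_{r-2} ∂^{r-2} + ⋯`. -/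
def IsNormalizedDiffOp (P : DSym K) (r : ℕ) : Prop :=
  0 < r ∧ IsMonicDiffOp P r ∧ P.cf (r - 1) = 0

/-- The extension of scalars `D̂₁^sym → D̂₁^sym ⊗̂ L`. -/
noncomputable def baseChange (L : Type*) [Field L] [Algebra K L] (P : DSym K) : DSym L :=
  ⟨fun k => PowerSeries.map (algebraMap K L) (P.cf k), by
    obtain ⟨d, hd⟩ := P.exists_ordLE
    refine ⟨d, fun k i h => hd k i fun h0 => h ?_⟩
    rw [PowerSeries.coeff_map, h0, map_zero]⟩

end Operators

/-! ### Normal forms -/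

section NormalForm

variable {K : Type*} [Field K] [CharZero K]

/-- The centraliser `C(∂^q)` in `D̂₁^sym`. -/
noncomputable def centr (K : Type*) [Field K] [CharZero K] (q : ℕ) : Subring (DSym K) :=
  Subring.centralizer {del K ^ q}

/-- `P'` is a normal form of `P` with respect to `Q`, where `Q` has order `q`: there is a Schur
operator for `Q`, i.e. a monic invertible `S` of order zero with `S Q S⁻¹ = ∂^q`, such that
`P' = S P S⁻¹`. -/
def IsNormalForm (P Q : DSym K) (q : ℕ) (P' : DSym K) : Prop :=
  ∃ S : (DSym K)ˣ, IsMonic (S : DSym K) 0 ∧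
    (S : DSym K) * Q * (↑S⁻¹ : DSym K) = del K ^ q ∧
    P' = (S : DSym K) * P * (↑S⁻¹ : DSym K)

end NormalForm

/-! ### Vector forms -/

section VectorForm

variable {L : Type*} [Field L]

/-- The operator `∑_{0 ≤ i < q} fᵢ Aᵢ`. -/
noncomputable def polyA (q : ℕ) (ξ : L) (f : Fin q → L) : DSym L :=
  ∑ i : Fin q, f i • opA ξ i

/-- The isomorphism `Φ`, sending `∑ᵢ fᵢ Aᵢ` to the vector whose `j`-th entry is
`∑ᵢ fᵢ ξ^{i j}`, `j` modulo `q`. -/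
noncomputable def Phi (q : ℕ) (ξ : L) (f : Fin q → L) : ZMod q → L :=
  fun j => ∑ i : Fin q, f i * ξ ^ ((i : ℕ) * j.val)

/-- `IsPhiHat q ξ P p` says that `Φ̂(P) = ∑ₗ pₗ D̃ˡ`, for an operator `P` over `K` of the shape
`∑ₗ (∑ᵢ f_{l,i} Aᵢ) Dˡ` over `L` (all elements of `C(∂^q)` have this shape):
`Φ̂` replaces each `∑ᵢ f_{l,i} Aᵢ` by its image under `Φ` and `Dˡ` by `D̃ˡ`.
The Laurent polynomial `∑ₗ pₗ D̃ˡ` is given by its family of coefficients `pₗ ∈ L^{⊕ q}`. -/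
def IsPhiHat {K : Type*} [Field K] [Algebra K L] [CharZero L] (q : ℕ) (ξ : L) (P : DSym K)
    (p : ℤ → ZMod q → L) : Prop :=
  ∃ f : ℤ →₀ (Fin q → L),
    baseChange L P = f.sum (fun l g => polyA q ξ g * opD L l) ∧ ∀ l, p l = Phi q ξ (f l)

end VectorForm

/-! ### Partial normalisation; here `q = d m` and `p = d n` -/

section Partial

/-- The set `N_{i,α} = {j | α + d (j n mod m) ≥ max {i, d}}`, `j` a positive integer. -/
def setN (d m n : ℕ) (i : ℤ) (α : ℕ) : Set ℕ :=
  {j | 0 < j ∧ max i (d : ℤ) ≤ (α : ℤ) + d * ((j * n) % m : ℕ)}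

/-- `j ≡ α + (k - 1) p` modulo `q` for some `0 ≤ α < d` and some `k ∈ N_{p-l,α}`. -/
def FirstRule (d m n : ℕ) (l : ℤ) (j : ZMod (d * m)) : Prop :=
  ∃ α k : ℕ, α < d ∧ k ∈ setN d m n ((d * n : ℕ) - l) α ∧
    j = (((α : ℤ) + ((k : ℤ) - 1) * (d * n : ℕ) : ℤ) : ZMod (d * m))

/-- `j` is one of the residues `0, …, -l-1` modulo `q`. -/
def SecondRule (d m : ℕ) (l : ℤ) (j : ZMod (d * m)) : Prop :=
  ∃ t : ℕ, (t : ℤ) ≤ -l - 1 ∧ j = (t : ZMod (d * m))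

/-- The list of pairs `(l, j)` for which the coefficient `p_{l,j}` is required to vanish. -/
def InVanishingList (d m n : ℕ) (l : ℤ) (j : ZMod (d * m)) : Prop :=
  -((d * m : ℕ) : ℤ) < l ∧ l < (d * n : ℕ) ∧
  ((d * m ≤ d * n ∧
      ((((d * n : ℕ) : ℤ) - (d * m : ℕ) < l ∧ FirstRule d m n l j) ∨
       (l < 0 ∧ SecondRule d m l j))) ∨
   (d * n < d * m ∧
      ((0 ≤ l ∧ FirstRule d m n l j) ∨
       (((d * n : ℕ) : ℤ) - (d * m : ℕ) < l ∧ l < 0 ∧ (SecondRule d m l j ∨ FirstRule d m n l j)) ∨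
       (l ≤ ((d * n : ℕ) : ℤ) - (d * m : ℕ) ∧ SecondRule d m l j))))

/-- `(l, j)` indexes a coordinate: `-q < l < p` and `(l, j)` is not in the vanishing list. -/
def IsCoordinate (d m n : ℕ) (l : ℤ) (j : ZMod (d * m)) : Prop :=
  -((d * m : ℕ) : ℤ) < l ∧ l < (d * n : ℕ) ∧ ¬ InVanishingList d m n l j

/-- `P' ∈ C(∂^q)` is in partially normalised form, and `c` is the family of coefficients of its
image under `Φ̂`: `Φ̂(P') = D̃^p + ∑_{l = -q+1}^{p-1} c_l D̃ˡ` with `c_{l,j} = 0` whenever `(l, j)`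
is in the vanishing list. -/
def IsPartiallyNormalized {K L : Type*} [Field K] [CharZero K] [Field L] [CharZero L] [Algebra K L]
    (d m n : ℕ) (ξ : L) (P' : DSym K) (c : ℤ → ZMod (d * m) → L) : Prop :=
  P' ∈ centr K (d * m) ∧ IsPhiHat (d * m) ξ P' c ∧
  c (d * n : ℕ) = 1 ∧
  (∀ l : ℤ, (l ≤ -((d * m : ℕ) : ℤ) ∨ ((d * n : ℕ) : ℤ) < l) → c l = 0) ∧
  ∀ l j, InVanishingList d m n l j → c l j = 0

/-- The monic operators of order zero `S = 1 + ∑_{l=1}^{q-1} s_l ∫ˡ ∈ C(∂^q)`, `q = d m`, with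
`Φ(s_l)_α = 0` for `α = 0, …, d-1` and all `l`. -/
def IsAdmissible {K L : Type*} [Field K] [CharZero K] [Field L] [CharZero L] [Algebra K L]
    (d m : ℕ) (ξ : L) (S : DSym K) : Prop :=
  S ∈ centr K (d * m) ∧
  ∃ s : ℕ → Fin (d * m) → L,
    baseChange L S = 1 + ∑ l ∈ Finset.Icc 1 (d * m - 1), polyA (d * m) ξ (s l) * integ L ^ l ∧
    ∀ l ∈ Finset.Icc 1 (d * m - 1), ∀ α < d, Phi (d * m) ξ (s l) (α : ZMod (d * m)) = 0

end Partial

end NormalForms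

open NormalForms

/-!
Operators of finite order are treated as matrices. In the topological basis `xʲ / j!` of `K[[x]]`
an operator of order at most `d` has a matrix vanishing above the `d`-th diagonal, every such
matrix occurs (`exists_mat_eq`), and products become matrix products with finite sums
(`mat_mul_of_support`). Here `∂` and `∫` are the two shifts, and `∑ᵢ fᵢ Aᵢ` is the diagonal matrix
with the `q`-periodic entries `Φ(f)`. So the coefficient `p_{l,j}` of the vector form of an
operator is the entry of its `l`-th diagonal in the rows `a ≡ j` modulo `q`
(`IsPhiHat.algebraMap_mat`), and the centraliser of `∂^q` consists of the matrices whose diagonals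
are `q`-periodic and which vanish in the blocks below the diagonal. The latter is the condition
`p_{l,j} = 0` for `j = 0, …, -l-1`, which therefore holds automatically. As all entries come from
`K`, the argument is carried out over `K`.

A Schur operator for `Q` is written down row by row (`Leads.exists_schur`), so `P` has a normal
form in the centraliser. Conjugation by a unitriangular `S` whose first non-zero diagonal below the
main one is the `-i`-th, with entries `s`, fixes the diagonals `p, …, p-i+1` and changes the diagonal
`p - i` by `s(a) - s(a + p)` (`mat_eq_of_conj`, `mat_add_eq_of_conj`). The rule defining `N_{i,α}`
says exactly that `(p-i, a)` is in the vanishing list when the residue `b` of `a + p` is at least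
`max i d` (`firstRule_of_le`, `le_of_firstRule`). On the other hand, `s` vanishes at the residues
below `i` because `S` centralises `∂^q`, and at those below `d` by the normalisation imposed on `S`;
so the unknowns `s(b)`, `b ≥ max i d`, match the conditions. Since `gcd(n, m) = 1`, every orbit of
the shift by `p` on `ℤ/q` meets `{0, …, d-1}`, whence the linear map `s ↦ (s(b) - s(b - p))` on
functions supported on `b ≥ max i d` is injective, hence bijective (`eq_zero_of_shift`,
`exists_shift_sub_eq`). Surjectivity gives a partially normalised form, one diagonal at a time
(`exists_normalized`); injectivity shows that an admissible `S` conjugating two partially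
normalised operators is `1` (`eq_one_of_conj`), which is the content of the other two assertions.
-/

namespace NormalForms

/-! ### Operators as matrices -/

section Mat

variable {K : Type*} [Field K]

/-- The matrix of (the action on `K[[x]]` of) an operator in the topological basis `xʲ / j!`:
the entry `mat P a j` is the coefficient of `xᵃ / a!` in `P (xʲ / j!)`. In this basis `∂` is the
shift, so that no factorials appear in the matrices of the standard operators. -/
noncomputable def mat (P : DSym K) (a j : ℕ) : K :=
  a.factorial * PowerSeries.coeff a (P.act (PowerSeries.X ^ j)) * (j.factorial : K)⁻¹

theorem coeff_act_eq_sum {P : DSym K} {d : ℕ} (h : OrdLE P.cf d) (g : K⟦X⟧) (a N : ℕ)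
    (hN : a + d < N) : PowerSeries.coeff a (P.act g) =
      ∑ r ∈ Finset.range N, PowerSeries.coeff r g *
        PowerSeries.coeff a (P.act (PowerSeries.X ^ r)) := by
  have key : ∀ f : K⟦X⟧, PowerSeries.coeff a (P.act f) =
      ∑ k ∈ Finset.range N, ∑ u ∈ Finset.HasAntidiagonal.antidiagonal a,
        PowerSeries.coeff u.1 (P.cf k) * (((u.2 + 1).ascFactorial k : K) *
          PowerSeries.coeff (u.2 + k) f) := by
    intro f
    unfold DSym.act
    rw [coeff_rawAct h f a N (by omega)]
    simp only [PowerSeries.coeff_mul, PowerSeries.coeff_iterate_derivative]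
  simp only [key, Finset.mul_sum]
  symm
  rw [Finset.sum_comm]
  refine Finset.sum_congr rfl fun k _ => ?_
  rw [Finset.sum_comm (s := Finset.range N)]
  refine Finset.sum_congr rfl fun u hu => ?_
  have hu' := Finset.HasAntidiagonal.mem_antidiagonal.mp hu
  by_cases hd : (d : ℤ) < (k : ℤ) - u.1
  · simp [h.coeff_eq_zero hd]
  · rw [Finset.sum_eq_single (u.2 + k)]
    · rw [PowerSeries.coeff_X_pow, if_pos rfl]; ring
    · intro r _ hr
      rw [PowerSeries.coeff_X_pow, if_neg (Ne.symm hr)]; ring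
    · intro hr
      rw [Finset.mem_range] at hr
      omega

theorem iterate_derivative_X_pow (k t : ℕ) (hfac : (t.factorial : K) ≠ 0) :
    (PowerSeries.derivative K)^[k] (PowerSeries.X ^ (k + t) : K⟦X⟧) =
      PowerSeries.C (((k + t).factorial : K) * (t.factorial : K)⁻¹) * PowerSeries.X ^ t := by
  ext v
  rw [PowerSeries.coeff_iterate_derivative, PowerSeries.coeff_X_pow, PowerSeries.coeff_C_mul,
    PowerSeries.coeff_X_pow]
  by_cases hv : v = t
  · subst hv
    have := Nat.factorial_mul_ascFactorial v k
    rw [if_pos (by omega), if_pos rfl, add_comm k v, ← this]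
    push_cast
    field_simp
  · rw [if_neg (by omega), if_neg hv]; simp

theorem iterate_derivative_X_pow_of_lt {k j : ℕ} (h : j < k) :
    (PowerSeries.derivative K)^[k] (PowerSeries.X ^ j : K⟦X⟧) = 0 := by
  ext v
  rw [PowerSeries.coeff_iterate_derivative, PowerSeries.coeff_X_pow, if_neg (by omega)]
  simp

theorem exists_natOrdLE (P : DSym K) : ∃ d : ℕ, OrdLE P.cf d := by
  obtain ⟨d, hd⟩ := P.exists_ordLE
  exact ⟨d.toNat, hd.mono (Int.self_le_toNat d)⟩

variable [CharZero K]

theorem mat_eq_sum (P : DSym K) (a j : ℕ) :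
    mat P a j = ∑ x ∈ Finset.HasAntidiagonal.antidiagonal j, if x.2 ≤ a then
      (a.factorial : K) * (x.2.factorial : K)⁻¹ * PowerSeries.coeff (a - x.2) (P.cf x.1) else 0 := by
  obtain ⟨d, hd⟩ := P.coeff_act_eq
  unfold mat
  rw [hd _ a (a + d + j + 1) (by omega), Finset.Nat.sum_antidiagonal_eq_sum_range_succ_mk,
    Finset.mul_sum, Finset.sum_mul]
  symm
  refine Finset.sum_subset_zero_on_sdiff (fun x hx => ?_) (fun k hk => ?_) (fun k hk => ?_)
  · rw [Finset.mem_range] at *; omega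
  · simp only [Finset.mem_sdiff, Finset.mem_range] at hk
    rw [iterate_derivative_X_pow_of_lt (by omega)]; simp
  · rw [Finset.mem_range] at hk
    obtain ⟨t, rfl⟩ : ∃ t, j = k + t := ⟨j - k, by omega⟩
    have h1 : (t.factorial : K) ≠ 0 := Nat.cast_ne_zero.mpr t.factorial_ne_zero
    have h2 : ((k + t).factorial : K) ≠ 0 := Nat.cast_ne_zero.mpr (k + t).factorial_ne_zero
    rw [iterate_derivative_X_pow k t h1]
    simp only [Nat.add_sub_cancel_left]
    rw [mul_left_comm, PowerSeries.coeff_C_mul, PowerSeries.coeff_mul_X_pow']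
    split_ifs
    · field_simp
    · simp

theorem mat_eq_zero {P : DSym K} {d : ℤ} (h : OrdLE P.cf d) {a j : ℕ} (haj : a + d < j) :
    mat P a j = 0 := by
  rw [mat_eq_sum]
  refine Finset.sum_eq_zero fun x hx => ?_
  have := Finset.HasAntidiagonal.mem_antidiagonal.mp hx
  split_ifs with hxa
  · rw [h.coeff_eq_zero (by push_cast [hxa]; omega), mul_zero]
  · rfl

theorem mat_mul_of_support (P Q : DSym K) (a j : ℕ) (s : Finset ℕ)
    (hs : ∀ k ∉ s, mat P a k * mat Q k j = 0) :
    mat (P * Q) a j = ∑ k ∈ s, mat P a k * mat Q k j := by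
  obtain ⟨d, hd⟩ := exists_natOrdLE P
  have h1 : mat (P * Q) a j = ∑ k ∈ Finset.range (a + d + 1), mat P a k * mat Q k j := by
    unfold mat
    rw [DSym.act_mul, coeff_act_eq_sum hd _ a (a + d + 1) (by omega), Finset.mul_sum,
      Finset.sum_mul]
    refine Finset.sum_congr rfl fun k _ => ?_
    have : (k.factorial : K) ≠ 0 := Nat.cast_ne_zero.mpr k.factorial_ne_zero
    field_simp
  have h2 : ∀ k ∉ Finset.range (a + d + 1), mat P a k * mat Q k j = 0 := fun k hk => by
    rw [Finset.mem_range] at hk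
    rw [mat_eq_zero hd (by omega), zero_mul]
  rw [h1, ← finsum_eq_finsetSum_of_support_subset (s := s),
    ← finsum_eq_finsetSum_of_support_subset]
  · exact fun k hk => by_contra fun hk' => hk (h2 k hk')
  · exact fun k hk => by_contra fun hk' => hk (hs k hk')

theorem mat_mul_single (P Q : DSym K) (a j i : ℕ) (h : ∀ k ≠ i, mat P a k * mat Q k j = 0) :
    mat (P * Q) a j = mat P a i * mat Q i j := by
  rw [mat_mul_of_support P Q a j {i} (fun k hk => h k (by simpa using hk)), Finset.sum_singleton]

theorem mat_injective {P Q : DSym K} (h : ∀ a j, mat P a j = mat Q a j) : P = Q := by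
  obtain ⟨d, hd⟩ := exists_natOrdLE P
  obtain ⟨e, he⟩ := exists_natOrdLE Q
  refine DSym.act_injective fun f => ?_
  ext a
  rw [coeff_act_eq_sum hd f a (a + d + e + 1) (by omega),
    coeff_act_eq_sum he f a (a + d + e + 1) (by omega)]
  refine Finset.sum_congr rfl fun r _ => ?_
  have h1 := h a r
  unfold mat at h1
  have h2 : (a.factorial : K) ≠ 0 := Nat.cast_ne_zero.mpr a.factorial_ne_zero
  have h3 : (r.factorial : K)⁻¹ ≠ 0 := inv_ne_zero (Nat.cast_ne_zero.mpr r.factorial_ne_zero)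
  rw [mul_left_cancel₀ h2 (mul_right_cancel₀ h3 h1)]

theorem mat_add (P Q : DSym K) (a j : ℕ) : mat (P + Q) a j = mat P a j + mat Q a j := by
  unfold mat
  rw [DSym.act_add, map_add]; ring

theorem mat_zero (a j : ℕ) : mat (0 : DSym K) a j = 0 := by
  have := mat_add (0 : DSym K) 0 a j
  rwa [add_zero, left_eq_add] at this

theorem mat_smul (c : K) (P : DSym K) (a j : ℕ) : mat (c • P) a j = c * mat P a j := by
  have hc : ∀ k, (c • P).cf k = c • P.cf k := fun k => rfl
  rw [mat_eq_sum, mat_eq_sum, Finset.mul_sum]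
  refine Finset.sum_congr rfl fun x _ => ?_
  rw [hc]
  split_ifs
  · rw [PowerSeries.coeff_smul]; simp only [smul_eq_mul]; ring
  · simp

theorem mat_sum {ι : Type*} (s : Finset ι) (P : ι → DSym K) (a j : ℕ) :
    mat (∑ i ∈ s, P i) a j = ∑ i ∈ s, mat (P i) a j := by
  classical
  induction s using Finset.induction_on with
  | empty => simp [mat_zero]
  | insert i s hi ih => rw [Finset.sum_insert hi, Finset.sum_insert hi, mat_add, ih]

theorem mat_baseChange {L : Type*} [Field L] [CharZero L] [Algebra K L] (P : DSym K) (a j : ℕ) :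
    mat (baseChange L P) a j = algebraMap K L (mat P a j) := by
  rw [mat_eq_sum, mat_eq_sum, map_sum]
  refine Finset.sum_congr rfl fun x _ => ?_
  have h : (baseChange L P).cf x.1 = PowerSeries.map (algebraMap K L) (P.cf x.1) := rfl
  split_ifs
  · rw [h, PowerSeries.coeff_map]; simp
  · simp

theorem mat_homComp (P : DSym K) (r : ℤ) (a j : ℕ) :
    mat (homComp P r) a j = if (j : ℤ) - a = r then mat P a j else 0 := by
  rw [mat_eq_sum, mat_eq_sum]
  have h : ∀ k, (homComp P r).cf k = PowerSeries.mk fun i =>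
    if (k : ℤ) - i = r then PowerSeries.coeff i (P.cf k) else 0 := fun k => rfl
  split_ifs with hr
  · refine Finset.sum_congr rfl fun x hx => ?_
    have := Finset.HasAntidiagonal.mem_antidiagonal.mp hx
    split_ifs
    · rw [h, PowerSeries.coeff_mk, if_pos (by omega)]
    · rfl
  · refine Finset.sum_eq_zero fun x hx => ?_
    have := Finset.HasAntidiagonal.mem_antidiagonal.mp hx
    split_ifs
    · rw [h, PowerSeries.coeff_mk, if_neg (by omega), mul_zero]
    · rfl

/-! ### Operators with a prescribed matrix -/

/-- A matrix with entries vanishing above the `d`-th diagonal is the matrix of an operator of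
order at most `d`. The coefficients are found from `P (xʲ/j!) = ∑_{k+t=j} aₖ xᵗ/t!` by inverting
the exponential generating series. -/
theorem exists_mat_eq (M : ℕ → ℕ → K) (d : ℕ) (hM : ∀ a j, a + d < j → M a j = 0) :
    ∃ P : DSym K, OrdLE P.cf d ∧ ∀ a j, mat P a j = M a j := by
  let A := K⟦X⟧
  let G : PowerSeries A := PowerSeries.mk fun j => PowerSeries.mk fun a =>
    M a j * (a.factorial : K)⁻¹
  let E : PowerSeries A := PowerSeries.rescale (PowerSeries.X : A) (PowerSeries.exp A)
  let E' : PowerSeries A := PowerSeries.rescale (PowerSeries.X : A)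
    (PowerSeries.evalNegHom (PowerSeries.exp A))
  have hE : E' * E = 1 := by
    rw [← map_mul, mul_comm, PowerSeries.exp_mul_exp_neg_eq_one, map_one]
  have hcE : ∀ t, PowerSeries.coeff t E = PowerSeries.C ((t.factorial : K)⁻¹) * PowerSeries.X ^ t := by
    intro t
    rw [PowerSeries.coeff_rescale, PowerSeries.coeff_exp, mul_comm]
    congr 1
    rw [IsScalarTower.algebraMap_apply ℚ K A]
    change PowerSeries.C _ = _
    simp
  have hcE' : ∀ t u, u < t → PowerSeries.coeff u (PowerSeries.coeff t E') = 0 := by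
    intro t u hu
    rw [PowerSeries.coeff_rescale, mul_comm, PowerSeries.coeff_mul_X_pow', if_neg (by omega)]
  let a : ℕ → A := fun k => PowerSeries.coeff k (G * E')
  have ha : OrdLE a d := by
    intro k i hne
    by_contra hlt
    apply hne
    change PowerSeries.coeff i (PowerSeries.coeff k (G * E')) = 0
    rw [PowerSeries.coeff_mul, map_sum]
    refine Finset.sum_eq_zero fun x hx => ?_
    have := Finset.HasAntidiagonal.mem_antidiagonal.mp hx
    rw [PowerSeries.coeff_mul]
    refine Finset.sum_eq_zero fun y hy => ?_
    have := Finset.HasAntidiagonal.mem_antidiagonal.mp hy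
    by_cases h1 : y.2 < x.2
    · rw [hcE' _ _ h1, mul_zero]
    · rw [PowerSeries.coeff_mk, PowerSeries.coeff_mk, hM _ _ (by omega), zero_mul, zero_mul]
  obtain ⟨P, hP⟩ : ∃ P : DSym K, P.cf = a := ⟨⟨a, d, ha⟩, rfl⟩
  refine ⟨P, hP ▸ ha, fun b j => ?_⟩
  rw [mat_eq_sum, hP]
  have h1 : PowerSeries.coeff j G = ∑ x ∈ Finset.HasAntidiagonal.antidiagonal j,
      a x.1 * (PowerSeries.C ((x.2.factorial : K)⁻¹) * PowerSeries.X ^ x.2) := by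
    have : G = G * E' * E := by rw [mul_assoc, hE, mul_one]
    rw [this, PowerSeries.coeff_mul]
    exact Finset.sum_congr rfl fun x _ => by rw [hcE]
  have h2 := congrArg (PowerSeries.coeff b) h1
  rw [PowerSeries.coeff_mk, PowerSeries.coeff_mk, map_sum] at h2
  have h3 : (b.factorial : K) ≠ 0 := Nat.cast_ne_zero.mpr b.factorial_ne_zero
  have h4 : M b j = b.factorial * (M b j * (b.factorial : K)⁻¹) := by field_simp
  rw [h4, h2, Finset.mul_sum]
  refine Finset.sum_congr rfl fun x _ => ?_
  rw [mul_left_comm, PowerSeries.coeff_C_mul, PowerSeries.coeff_mul_X_pow']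
  split_ifs
  · ring
  · simp

theorem ordLE_of_mat {P : DSym K} {d : ℕ} (h : ∀ a j, a + d < j → mat P a j = 0) :
    OrdLE P.cf d := by
  obtain ⟨P', hP', hm⟩ := exists_mat_eq (mat P) d h
  rwa [← mat_injective hm]

end Mat

/-! ### Matrices of the standard operators -/

section Standard

variable {K : Type*} [Field K] [CharZero K]

theorem mat_one (a j : ℕ) : mat (1 : DSym K) a j = if a = j then 1 else 0 := by
  unfold mat
  rw [DSym.act_one, PowerSeries.coeff_X_pow]
  split_ifs with h
  · subst h
    have : (a.factorial : K) ≠ 0 := Nat.cast_ne_zero.mpr a.factorial_ne_zero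
    field_simp
  · simp

theorem mat_del (a j : ℕ) : mat (del K) a j = if j = a + 1 then 1 else 0 := by
  rw [mat_eq_sum]
  have h : ∀ k, (del K).cf k = if k = 1 then 1 else 0 := fun k => rfl
  have ha : (a.factorial : K) ≠ 0 := Nat.cast_ne_zero.mpr a.factorial_ne_zero
  simp only [h]
  split_ifs with hj
  · subst hj
    rw [Finset.sum_eq_single (1, a)]
    · simp [ha]
    · rintro ⟨k, t⟩ hx hne
      have hx' := Finset.HasAntidiagonal.mem_antidiagonal.mp hx
      rw [if_neg (fun hk : k = 1 => hne (by subst hk; ext <;> simp at hx' ⊢; omega))]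
      simp
    · intro hx
      exact absurd (Finset.HasAntidiagonal.mem_antidiagonal.mpr (by simp; omega)) hx
  · refine Finset.sum_eq_zero fun x hx => ?_
    have hx' := Finset.HasAntidiagonal.mem_antidiagonal.mp hx
    split_ifs with h1 h2
    · rw [PowerSeries.coeff_one, if_neg (by omega), mul_zero]
    · simp
    · rfl

theorem mat_del_pow (n a j : ℕ) : mat (del K ^ n) a j = if j = a + n then 1 else 0 := by
  induction n generalizing j with
  | zero => rw [pow_zero, mat_one]; simp [eq_comm]
  | succ n ih =>
    rw [pow_succ, mat_mul_single _ _ a j (a + n) fun k hk => by rw [ih, if_neg hk, zero_mul],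
      ih, if_pos rfl, one_mul, mat_del]
    rfl

theorem mat_integ (a j : ℕ) : mat (integ K) a j = if a = j + 1 then 1 else 0 := by
  rw [mat_eq_sum]
  have h : ∀ k, (integ K).cf k =
    PowerSeries.monomial (k + 1) ((-1) ^ k * ((k + 1).factorial : K)⁻¹) := fun k => rfl
  simp only [h, PowerSeries.coeff_monomial]
  split_ifs with hj
  · subst hj
    have hb : ∀ x ∈ Finset.HasAntidiagonal.antidiagonal j, (if x.2 ≤ j + 1 then
        ((j + 1).factorial : K) * (x.2.factorial : K)⁻¹ * (if j + 1 - x.2 = x.1 + 1 then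
          (-1) ^ x.1 * ((x.1 + 1).factorial : K)⁻¹ else 0) else 0) =
        (-1) ^ x.1 * ((j + 1).choose (x.1 + 1) : K) := by
      rintro ⟨k, t⟩ hx
      have hx' := Finset.HasAntidiagonal.mem_antidiagonal.mp hx
      simp only at hx' ⊢
      have hk : ((k + 1).factorial : K) ≠ 0 := Nat.cast_ne_zero.mpr (k + 1).factorial_ne_zero
      have ht : (t.factorial : K) ≠ 0 := Nat.cast_ne_zero.mpr t.factorial_ne_zero
      rw [if_pos (by omega), if_pos (by omega), Nat.cast_choose K (by omega : k + 1 ≤ j + 1),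
        show j + 1 - (k + 1) = t by omega]
      field_simp
    rw [Finset.sum_congr rfl hb, Finset.Nat.sum_antidiagonal_eq_sum_range_succ_mk]
    have h0 := Int.alternating_sum_range_choose (n := j + 1)
    rw [Finset.sum_range_succ'] at h0
    have h1 := congrArg (fun z : ℤ => (z : K)) h0
    simp only [Nat.add_eq_zero_iff, one_ne_zero, and_false, if_false] at h1
    push_cast at h1
    simp only [pow_succ, Nat.choose_zero_right, Nat.cast_one] at h1
    rw [← sub_eq_zero, ← neg_eq_zero, ← h1]
    simp [Finset.sum_neg_distrib]
    ring
  · refine Finset.sum_eq_zero fun x hx => ?_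
    have hx' := Finset.HasAntidiagonal.mem_antidiagonal.mp hx
    split_ifs with h1 h2
    · omega
    · simp
    · rfl

theorem mat_integ_pow (n a j : ℕ) : mat (integ K ^ n) a j = if a = j + n then 1 else 0 := by
  induction n generalizing a with
  | zero => rw [pow_zero, mat_one]; simp
  | succ n ih =>
    rw [pow_succ', mat_mul_single _ _ a j (j + n) fun k hk => by rw [ih, if_neg hk, mul_zero],
      ih, if_pos rfl, mul_one, mat_integ]
    rfl

theorem mat_opD (l : ℤ) (a j : ℕ) : mat (opD K l) a j = if (j : ℤ) - a = l then 1 else 0 := by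
  unfold opD
  split_ifs with h1 h2 h2
  · rw [mat_del_pow, if_pos (by omega)]
  · rw [mat_del_pow, if_neg (by omega)]
  · rw [mat_integ_pow, if_pos (by omega)]
  · rw [mat_integ_pow, if_neg (by omega)]

theorem mat_expStar (c : K) (a j : ℕ) :
    mat (expStar c) a j = if a = j then (1 + c) ^ j else 0 := by
  rw [mat_eq_sum]
  have h : ∀ k, (expStar c).cf k = PowerSeries.monomial k (c ^ k * (k.factorial : K)⁻¹) :=
    fun k => rfl
  simp only [h, PowerSeries.coeff_monomial]
  split_ifs with hj
  · subst hj
    rw [add_comm, (Commute.all c 1).add_pow']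
    refine Finset.sum_congr rfl ?_
    rintro ⟨k, t⟩ hx
    have hx' := Finset.HasAntidiagonal.mem_antidiagonal.mp hx
    simp only at hx' ⊢
    have hk : (k.factorial : K) ≠ 0 := Nat.cast_ne_zero.mpr k.factorial_ne_zero
    have ht : (t.factorial : K) ≠ 0 := Nat.cast_ne_zero.mpr t.factorial_ne_zero
    rw [if_pos (by omega), if_pos (by omega), nsmul_eq_mul,
      Nat.cast_choose K (by omega : k ≤ a), show a - k = t by omega]
    field_simp
    simp
  · refine Finset.sum_eq_zero fun x hx => ?_
    have hx' := Finset.HasAntidiagonal.mem_antidiagonal.mp hx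
    split_ifs with h1 h2
    · omega
    · simp
    · rfl

theorem mat_polyA {q : ℕ} {ξ : K} (hξ : ξ ^ q = 1) (f : Fin q → K) (a j : ℕ) :
    mat (polyA q ξ f) a j = if a = j then Phi q ξ f (a : ZMod q) else 0 := by
  unfold polyA
  rw [mat_sum]
  split_ifs with h
  · subst h
    unfold Phi
    refine Finset.sum_congr rfl fun i _ => ?_
    rw [mat_smul, opA, mat_expStar, if_pos rfl, add_sub_cancel, ZMod.val_natCast, ← pow_mul]
    congr 1
    conv_lhs => rw [← Nat.mod_add_div a q]
    rw [mul_add, pow_add, mul_left_comm, pow_mul ξ q, hξ, one_pow, mul_one]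
  · exact Finset.sum_eq_zero fun i _ => by rw [mat_smul, opA, mat_expStar, if_neg h, mul_zero]

theorem mat_polyA_mul {q : ℕ} {ξ : K} (hξ : ξ ^ q = 1) (f : Fin q → K) (P : DSym K) (a j : ℕ) :
    mat (polyA q ξ f * P) a j = Phi q ξ f (a : ZMod q) * mat P a j := by
  rw [mat_mul_single _ _ a j a fun k hk => by rw [mat_polyA hξ, if_neg hk.symm, zero_mul],
    mat_polyA hξ, if_pos rfl]

theorem mem_centr_iff {q : ℕ} {P : DSym K} : P ∈ centr K q ↔
    ∀ a j, mat P (a + q) j = if q ≤ j then mat P a (j - q) else 0 := by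
  have h1 : ∀ a j, mat (del K ^ q * P) a j = mat P (a + q) j := fun a j => by
    rw [mat_mul_single _ _ a j (a + q) fun k hk => by rw [mat_del_pow, if_neg hk, zero_mul],
      mat_del_pow, if_pos rfl, one_mul]
  have h2 : ∀ a j, mat (P * del K ^ q) a j = if q ≤ j then mat P a (j - q) else 0 := fun a j => by
    rw [mat_mul_single _ _ a j (j - q) fun k hk => by
      rw [mat_del_pow, if_neg (by omega), mul_zero], mat_del_pow]
    split_ifs with h3 h4 h4
    · rw [mul_one]
    · omega
    · omega
    · rw [mul_zero]
  unfold centr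
  rw [Subring.mem_centralizer_iff]
  simp only [Set.mem_singleton_iff, forall_eq]
  constructor
  · intro h a j
    rw [← h1, ← h2, h]
  · intro h
    exact mat_injective fun a j => by rw [h1, h2, h]

end Standard

/-! ### Monic operators -/

section Monic

variable {K : Type*} [Field K] [CharZero K]

/-- The matrix form of "`P` is monic of order `r`": the entries of the matrix vanish above the
`r`-th diagonal and are `1` on it. -/
def Leads (P : DSym K) (r : ℕ) : Prop :=
  (∀ a j, a + r < j → mat P a j = 0) ∧ ∀ a, mat P a (a + r) = 1

theorem leads_one : Leads (1 : DSym K) 0 :=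
  ⟨fun a j h => by rw [mat_one, if_neg (by omega)], fun a => by rw [mat_one, if_pos (add_zero a).symm]⟩

theorem Leads.mul {P Q : DSym K} {r s : ℕ} (hP : Leads P r) (hQ : Leads Q s) :
    Leads (P * Q) (r + s) := by
  constructor
  · intro a j h
    rw [mat_mul_of_support P Q a j ∅ fun k _ => ?_, Finset.sum_empty]
    by_cases hk : a + r < k
    · rw [hP.1 a k hk, zero_mul]
    · rw [hQ.1 k j (by omega), mul_zero]
  · intro a
    rw [mat_mul_single P Q a _ (a + r) fun k hk => ?_, hP.2, ← add_assoc, hQ.2, one_mul]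
    by_cases hk : a + r < k
    · rw [hP.1 a k hk, zero_mul]
    · rw [hQ.1 k _ (by omega), mul_zero]

theorem Leads.pow {P : DSym K} {r : ℕ} (hP : Leads P r) (n : ℕ) : Leads (P ^ n) (n * r) := by
  induction n with
  | zero => simpa using leads_one
  | succ n ih =>
    rw [pow_succ, Nat.succ_mul]
    exact ih.mul hP

theorem IsMonicDiffOp.leads {P : DSym K} {r : ℕ} (h : IsMonicDiffOp P r) : Leads P r := by
  have hord : OrdLE P.cf r := fun k i hne => by
    by_contra hlt
    rw [h.2 k (by omega)] at hne
    simp at hne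
  refine ⟨fun a j haj => mat_eq_zero hord (by omega), fun a => ?_⟩
  rw [mat_eq_sum, Finset.sum_eq_single (r, a)]
  · have ha : (a.factorial : K) ≠ 0 := Nat.cast_ne_zero.mpr a.factorial_ne_zero
    simp [h.1, ha]
  · rintro ⟨k, t⟩ hx hne
    have hx' := Finset.HasAntidiagonal.mem_antidiagonal.mp hx
    simp only at hx' ⊢
    split_ifs with hta
    · rcases lt_trichotomy k r with hk | hk | hk
      · omega
      · exact absurd (Prod.ext hk (by simp; omega)) hne
      · rw [h.2 k hk, map_zero, mul_zero]
    · rfl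
  · intro hx
    exact absurd (Finset.HasAntidiagonal.mem_antidiagonal.mpr (by simp; omega)) hx

theorem Leads.isMonic {P : DSym K} {r : ℕ} (h : Leads P r) : IsMonic P r := by
  refine ⟨ordLE_of_mat h.1, mat_injective fun a j => ?_⟩
  rw [mat_homComp, mat_del_pow]
  split_ifs with h1 h2 h2
  · rw [h2, h.2]
  · omega
  · omega
  · rfl

/-- The rows of a right inverse of a unitriangular matrix `S`. -/
def invRow (S : ℕ → ℕ → K) (a : ℕ) : ℕ → K := fun j =>
  (if a = j then 1 else 0) - ∑ k : Fin a, S a k * invRow S k j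
decreasing_by exact k.2

theorem Leads.exists_rightInverse {S : DSym K} (h : Leads S 0) : ∃ T : DSym K, Leads T 0 ∧
    S * T = 1 := by
  have hrec : ∀ a j, invRow (mat S) a j =
      (if a = j then 1 else 0) - ∑ k ∈ Finset.range a, mat S a k * invRow (mat S) k j := by
    intro a j
    rw [invRow, Finset.sum_range]
  have hz : ∀ a j, a < j → invRow (mat S) a j = 0 := by
    intro a
    induction a using Nat.strong_induction_on with
    | _ a ih =>
      intro j hj
      rw [hrec, if_neg (by omega), Finset.sum_eq_zero, sub_zero]
      intro k hk
      rw [Finset.mem_range] at hk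
      rw [ih k hk j (by omega), mul_zero]
  obtain ⟨T, -, hT⟩ := exists_mat_eq (invRow (mat S)) 0 fun a j h => hz a j (by omega)
  refine ⟨T, ⟨fun a j h => by rw [hT, hz a j (by omega)], fun a => ?_⟩, ?_⟩
  · rw [add_zero, hT, hrec, if_pos rfl, Finset.sum_eq_zero, sub_zero]
    intro k hk
    rw [Finset.mem_range] at hk
    rw [hz k a hk, mul_zero]
  · refine mat_injective fun a j => ?_
    rw [mat_mul_of_support S T a j (Finset.range (a + 1)) fun k hk => ?_, Finset.sum_range_succ,
      mat_one]
    · have h1 := h.2 a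
      rw [add_zero] at h1
      rw [h1, one_mul, hT a j, hrec a j]
      simp only [hT]
      ring
    · rw [Finset.mem_range] at hk
      rw [h.1 a k (by omega), zero_mul]

theorem Leads.exists_unit {S : DSym K} (h : Leads S 0) :
    ∃ U : (DSym K)ˣ, (U : DSym K) = S ∧ Leads (↑U⁻¹ : DSym K) 0 := by
  obtain ⟨T, hT, hST⟩ := h.exists_rightInverse
  obtain ⟨S', -, hTS⟩ := hT.exists_rightInverse
  have : S = S' := by
    rw [← mul_one S, ← hTS, ← mul_assoc, hST, one_mul]
  exact ⟨⟨S, T, hST, this ▸ hTS⟩, rfl, hT⟩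

/-- Existence of a Schur operator. The identity `S Q = ∂^q S` says that the row `a + q` of the
matrix of `S` is the row `a` multiplied by `Q`; so the first `q` rows may be taken from the
identity matrix, and the row `a` of `S` is the row `a % q` of `Q ^ (a / q)`. -/
theorem Leads.exists_schur {Q : DSym K} {q : ℕ} (hq : 0 < q) (hQ : Leads Q q) :
    ∃ S : DSym K, Leads S 0 ∧ S * Q = del K ^ q * S := by
  have hpow := fun n => hQ.pow n
  have hz : ∀ a j, a + 0 < j → mat (Q ^ (a / q)) (a % q) j = 0 := fun a j h => by
    have := Nat.mod_add_div a q
    rw [mul_comm] at this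
    exact (hpow _).1 _ _ (by omega)
  obtain ⟨S, -, hS⟩ := exists_mat_eq (fun a j => mat (Q ^ (a / q)) (a % q) j) 0 hz
  refine ⟨S, ⟨fun a j h => by rw [hS, hz a j h], fun a => ?_⟩, mat_injective fun a j => ?_⟩
  · rw [hS, add_zero]
    have := (hpow (a / q)).2 (a % q)
    rwa [mul_comm, Nat.mod_add_div] at this
  · have h0 : ∀ k ∉ Finset.range (a + 1), mat S a k * mat Q k j = 0 := fun k hk => by
      rw [Finset.mem_range] at hk
      rw [hS, hz a k (by omega), zero_mul]
    rw [mat_mul_of_support _ _ a j _ h0, mat_mul_single _ _ a j (a + q) fun k hk => by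
      rw [mat_del_pow, if_neg hk, zero_mul], mat_del_pow, if_pos rfl, one_mul, hS (a + q) j,
      Nat.add_mod_right, Nat.add_div_right _ hq, pow_succ,
      mat_mul_of_support (Q ^ (a / q)) Q (a % q) j (Finset.range (a + 1)) fun k hk => ?_]
    · simp only [hS]
    · have := h0 k hk
      rwa [hS] at this

end Monic

/-! ### The vanishing list and the difference equation on `ℤ/q` -/

section Residues

theorem exists_val_sub_mul_lt {d m n : ℕ} (hd : 0 < d) (hm : 0 < m) (hnm : Nat.Coprime n m)
    (b : ZMod (d * m)) : ∃ k : ℕ, (b - k * ((d * n : ℕ) : ZMod (d * m))).val < d := by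
  have : NeZero (d * m) := ⟨(Nat.mul_pos hd hm).ne'⟩
  have : NeZero m := ⟨hm.ne'⟩
  set t := b.val / d with ht
  obtain ⟨k, hk⟩ : ∃ k : ℕ, ((k * n : ℕ) : ZMod m) = t := by
    refine ⟨((t : ZMod m) * (n : ZMod m)⁻¹).val, ?_⟩
    rw [Nat.cast_mul, ZMod.natCast_val, ZMod.cast_id, mul_assoc, mul_comm _ (n : ZMod m),
      ZMod.coe_mul_inv_eq_one n hnm, mul_one]
  refine ⟨k, ?_⟩
  rw [ZMod.natCast_eq_natCast_iff] at hk
  have h1 : d * (k * n) ≡ d * t [MOD (d * m)] := Nat.ModEq.mul_left' d hk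
  rw [← ZMod.natCast_eq_natCast_iff] at h1
  have h2 : b = ((b.val % d : ℕ) : ZMod (d * m)) + ((d * t : ℕ) : ZMod (d * m)) := by
    rw [← Nat.cast_add, ht, Nat.mod_add_div, ZMod.natCast_val, ZMod.cast_id]
  have h3 : b - k * ((d * n : ℕ) : ZMod (d * m)) = ((b.val % d : ℕ) : ZMod (d * m)) := by
    rw [← Nat.cast_mul, show k * (d * n) = d * (k * n) by ring, h1, sub_eq_iff_eq_add, ← h2]
  rw [h3, ZMod.val_natCast]
  exact (Nat.mod_le _ _).trans_lt (Nat.mod_lt _ hd)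

theorem val_natCast_add_mul {d m n α k : ℕ} (hm : 0 < m) (hα : α < d) :
    ((α + k * (d * n) : ℕ) : ZMod (d * m)).val = α + d * (k * n % m) := by
  have hlt : k * n % m + 1 ≤ m := Nat.mod_lt _ hm
  have hlt' : α + d * (k * n % m) < d * m := by nlinarith
  have h1 : α + k * (d * n) = α + d * (k * n % m) + d * m * (k * n / m) := by
    have := Nat.mod_add_div (k * n) m
    calc α + k * (d * n) = α + d * (k * n) := by ring
      _ = α + d * (k * n % m + m * (k * n / m)) := by rw [this]
      _ = _ := by ring
  rw [ZMod.val_natCast, h1, Nat.add_mul_mod_self_left, Nat.mod_eq_of_lt hlt']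

theorem firstRule_of_le {d m n : ℕ} (hd : 0 < d) (hm : 0 < m) (hnm : Nat.Coprime n m) {l : ℤ}
    {j : ZMod (d * m)}
    (h : max (((d * n : ℕ) : ℤ) - l) d ≤ ((j + ((d * n : ℕ) : ZMod (d * m))).val : ℤ)) :
    FirstRule d m n l j := by
  have : NeZero (d * m) := ⟨(Nat.mul_pos hd hm).ne'⟩
  set b := j + ((d * n : ℕ) : ZMod (d * m)) with hb
  obtain ⟨k, hk⟩ := exists_val_sub_mul_lt hd hm hnm b
  set α := (b - k * ((d * n : ℕ) : ZMod (d * m))).val with hα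
  have hbα : b = ((α + k * (d * n) : ℕ) : ZMod (d * m)) := by
    rw [Nat.cast_add, hα, ZMod.natCast_val, ZMod.cast_id]
    push_cast
    ring
  have hval : b.val = α + d * (k * n % m) := by
    rw [hbα, val_natCast_add_mul hm hk]
  refine ⟨α, k, hk, ⟨?_, ?_⟩, ?_⟩
  · rcases Nat.eq_zero_or_pos k with rfl | h0
    · exfalso
      have := (le_max_right _ _).trans h
      rw [hval] at this
      simp at this
      omega
    · exact h0
  · rw [hval] at h
    push_cast at h ⊢
    exact h
  · have : j = b - ((d * n : ℕ) : ZMod (d * m)) := by rw [hb, add_sub_cancel_right]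
    rw [this, hbα]
    push_cast
    ring

theorem le_of_firstRule {d m n : ℕ} (hm : 0 < m) {l : ℤ}
    {j : ZMod (d * m)} (h : FirstRule d m n l j) :
    max (((d * n : ℕ) : ℤ) - l) d ≤ ((j + ((d * n : ℕ) : ZMod (d * m))).val : ℤ) := by
  obtain ⟨α, k, hα, ⟨-, hk⟩, rfl⟩ := h
  have h2 : (((α : ℤ) + ((k : ℤ) - 1) * (d * n : ℕ) : ℤ) : ZMod (d * m)) +
      ((d * n : ℕ) : ZMod (d * m)) = ((α + k * (d * n) : ℕ) : ZMod (d * m)) := by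
    push_cast
    ring
  rw [h2, val_natCast_add_mul hm hα]
  push_cast at hk ⊢
  exact hk

/-- A function on `ℤ/q` supported on a set `T` which does not contain a full orbit of the shift
by `p` is determined by its differences `s b - s (b - p)`, `b ∈ T`. -/
theorem eq_zero_of_shift {A K : Type*} [CommRing A] [Zero K] {T : Set A} {p : A}
    (hT : ∀ b, ∃ k : ℕ, b - k * p ∉ T) {s : A → K} (h0 : ∀ b ∉ T, s b = 0)
    (h1 : ∀ b ∈ T, s b = s (b - p)) : s = 0 := by
  funext b
  obtain ⟨k, hk⟩ := hT b
  induction k generalizing b with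
  | zero => exact h0 b (by simpa using hk)
  | succ k ih =>
    by_cases hb : b ∈ T
    · rw [h1 b hb]
      refine ih _ ?_
      rwa [Nat.cast_succ, add_mul, one_mul, add_comm, ← sub_sub] at hk
    · exact h0 b hb

theorem exists_shift_sub_eq {A K : Type*} [CommRing A] [Finite A] [Field K] {T : Set A} {p : A}
    (hT : ∀ b, ∃ k : ℕ, b - k * p ∉ T) (R : A → K) :
    ∃ s : A → K, (∀ b ∉ T, s b = 0) ∧ ∀ b ∈ T, s b - s (b - p) = R b := by
  classical
  let ext : (T → K) → A → K := fun s b => if h : b ∈ T then s ⟨b, h⟩ else 0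
  let φ : (T → K) →ₗ[K] (T → K) :=
    { toFun := fun s b => ext s b - ext s (b - p)
      map_add' := fun s t => by
        funext b
        simp only [ext, Pi.add_apply]
        split_ifs <;> ring
      map_smul' := fun c s => by
        funext b
        simp only [ext, Pi.smul_apply, smul_eq_mul, RingHom.id_apply]
        split_ifs <;> ring }
  have hinj : Function.Injective φ := by
    rw [injective_iff_map_eq_zero]
    intro s hs
    have : ext s = 0 := eq_zero_of_shift hT (fun b hb => dif_neg hb) fun b hb =>
      sub_eq_zero.mp (congrFun hs ⟨b, hb⟩)
    funext b
    have h := congrFun this b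
    simpa [ext] using h
  obtain ⟨s, hs⟩ := LinearMap.injective_iff_surjective.mp hinj fun b => R b
  exact ⟨ext s, fun b hb => dif_neg hb, fun b hb => congrFun hs ⟨b, hb⟩⟩

theorem diag_eq {K : Type*} {q : ℕ} {c : ℤ → ZMod q → K} {M : ℕ → ℕ → K}
    (hc : ∀ a j : ℕ, M a j = c ((j : ℤ) - a) (a : ZMod q)) {a j : ℕ} {x : ZMod q} {l : ℤ}
    (ha : (a : ZMod q) = x) (hj : (j : ℤ) - a = l) : c l x = M a j := by
  rw [hc, ha, hj]

end Residues

/-! ### The matrices of elements of the centraliser of `∂^q` -/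

section Centraliser

variable {K : Type*} [Field K] [CharZero K] {q : ℕ}

theorem mat_add_mul_of_mem_centr {P : DSym K} (hP : P ∈ centr K q) (t a j : ℕ) :
    mat P (a + q * t) (j + q * t) = mat P a j := by
  induction t with
  | zero => rfl
  | succ t ih =>
    rw [Nat.mul_succ, ← add_assoc, ← add_assoc, mem_centr_iff.mp hP, if_pos (by omega),
      Nat.add_sub_cancel, ih]

/-- The blocks below the diagonal in the matrix of an element of the centraliser vanish. -/
theorem mat_eq_zero_of_mem_centr {P : DSym K} (hP : P ∈ centr K q) (t : ℕ) {a j : ℕ}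
    (hj : j < q * t) (ha : q * t ≤ a) : mat P a j = 0 := by
  induction t generalizing a j with
  | zero => simp at hj
  | succ t ih =>
    rw [Nat.mul_succ] at hj ha
    obtain ⟨b, rfl⟩ : ∃ b, a = b + q := ⟨a - q, by omega⟩
    rw [mem_centr_iff.mp hP]
    split_ifs
    · exact ih (by omega) (by omega)
    · rfl

theorem mat_eq_zero_of_mod_lt {P : DSym K} (hP : P ∈ centr K q) {a j : ℕ} (h : j + a % q < a) :
    mat P a j = 0 := by
  have := Nat.mod_add_div a q
  exact mat_eq_zero_of_mem_centr hP (a / q) (by omega) (by omega)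

/-- The diagonals of the matrix of an element of the centraliser are periodic. -/
theorem exists_diag [NeZero q] {P : DSym K} (hP : P ∈ centr K q) :
    ∃ c : ℤ → ZMod q → K, (∀ a j : ℕ, mat P a j = c ((j : ℤ) - a) (a : ZMod q)) ∧
      (∀ l ≤ -(q : ℤ), c l = 0) := by
  -- For `l > -q` the row `x.val + q` meets the diagonal `l`, so `toNat` does not truncate.
  refine ⟨fun l x => if l ≤ -(q : ℤ) then 0 else
    mat P (x.val + q) ((x.val + q : ℕ) + l).toNat, fun a j => ?_, fun l hl => ?_⟩
  · have h0 := Nat.mod_add_div a q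
    have hlt := Nat.mod_lt a (NeZero.pos q)
    simp only
    split_ifs with h
    · exact mat_eq_zero_of_mod_lt hP (by omega)
    · rw [← mat_add_mul_of_mem_centr hP 1 a j, mul_one, ZMod.val_natCast]
      have e1 : a + q = (a % q + q) + q * (a / q) := by omega
      have e2 : j + q = (((a % q + q : ℕ) : ℤ) + ((j : ℤ) - a)).toNat + q * (a / q) := by
        zify at h0 ⊢
        rw [Int.toNat_of_nonneg (by omega)]
        linarith
      rw [e1, e2, mat_add_mul_of_mem_centr hP]
  · funext x
    simp [hl]

/-- Periodic diagonals vanishing at the residues `0, …, -l-1` for `l < 0` define an element of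
the centraliser. -/
theorem mem_centr_of_diag [NeZero q] {P : DSym K} {c : ℤ → ZMod q → K}
    (hc : ∀ a j : ℕ, mat P a j = c ((j : ℤ) - a) (a : ZMod q))
    (h0 : ∀ l x, (x.val : ℤ) < -l → c l x = 0) : P ∈ centr K q := by
  rw [mem_centr_iff]
  intro a j
  split_ifs with h
  · rw [hc, hc]
    congr 1
    · push_cast [h]; ring
    · simp
  · rw [hc]
    refine h0 _ _ ?_
    rw [ZMod.val_natCast]
    have := Nat.mod_le a q
    rw [Nat.add_mod_right]
    push_cast
    omega

end Centraliser

/-! ### Conjugation, diagonal by diagonal -/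

section Conjugation

variable {K : Type*} [Field K] [CharZero K] {X Y S : DSym K} {p i : ℕ}

/-- If the diagonals `-1, …, -(i-1)` of a unitriangular `S` vanish and `S X = Y S`, then `X` and
`Y` agree on the diagonals `p, …, p-i+1`. -/
theorem mat_eq_of_conj (hX : Leads X p) (hY : Leads Y p) (hS : Leads S 0)
    (hi : ∀ a j, j < a → a < j + i → mat S a j = 0) (h : S * X = Y * S) {k a j : ℕ} (hk : k < i)
    (haj : a + p = j + k) : mat X a j = mat Y a j := by
  have h1 : mat (S * X) a j = mat X a j := by
    rw [mat_mul_single S X a j a fun r hr => ?_]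
    · have := hS.2 a
      rw [add_zero] at this
      rw [this, one_mul]
    · rcases lt_or_ge a r with h1 | h1
      · rw [hS.1 a r (by omega), zero_mul]
      · rcases lt_or_ge (r + p) j with h2 | h2
        · rw [hX.1 r j h2, mul_zero]
        · rw [hi a r (by omega) (by omega), zero_mul]
  have h2 : mat (Y * S) a j = mat Y a j := by
    rw [mat_mul_single Y S a j j fun r hr => ?_]
    · have := hS.2 j
      rw [add_zero] at this
      rw [this, mul_one]
    · rcases lt_or_ge (a + p) r with h1 | h1
      · rw [hY.1 a r h1, zero_mul]
      · rcases lt_or_ge r j with h2 | h2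
        · rw [hS.1 r j (by omega), mul_zero]
        · rw [hi r j (by omega) (by omega), mul_zero]
  rw [← h1, h, h2]

/-- The first diagonal of `S` below the main one changes the diagonal `p - i` by a difference. -/
theorem mat_add_eq_of_conj (hX : Leads X p) (hY : Leads Y p) (hS : Leads S 0) (hi0 : 0 < i)
    (hi : ∀ a j, j < a → a < j + i → mat S a j = 0) (h : S * X = Y * S) {a j : ℕ}
    (haj : a + p = j + i) :
    mat X a j + (if i ≤ a then mat S a (a - i) else 0) = mat Y a j + mat S (a + p) j := by
  have hS1 : ∀ b, mat S b b = 1 := hS.2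
  have h1 : mat (S * X) a j = mat X a j + (if i ≤ a then mat S a (a - i) else 0) := by
    have hz : ∀ r, r ≠ a → r + i ≠ a → mat S a r * mat X r j = 0 := by
      intro r h1 h2
      rcases lt_or_ge a r with h3 | h3
      · rw [hS.1 a r (by omega), zero_mul]
      · rcases lt_or_ge (r + p) j with h4 | h4
        · rw [hX.1 r j h4, mul_zero]
        · rw [hi a r (by omega) (by omega), zero_mul]
    split_ifs with hia
    · rw [mat_mul_of_support S X a j {a, a - i} fun r hr => ?_, Finset.sum_pair (by omega), hS1,
        one_mul]
      · have := hX.2 (a - i)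
        rw [show a - i + p = j by omega] at this
        rw [this, mul_one]
      · simp only [Finset.mem_insert, Finset.mem_singleton, not_or] at hr
        exact hz r hr.1 (by omega)
    · rw [mat_mul_single S X a j a fun r hr => hz r hr (by omega), hS1, one_mul, add_zero]
  have h2 : mat (Y * S) a j = mat Y a j + mat S (a + p) j := by
    rw [mat_mul_of_support Y S a j {j, a + p} fun r hr => ?_, Finset.sum_pair (by omega), hS1,
      mul_one, hY.2, one_mul]
    simp only [Finset.mem_insert, Finset.mem_singleton, not_or] at hr
    rcases lt_or_ge (a + p) r with h1 | h1
    · rw [hY.1 a r h1, zero_mul]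
    · rcases lt_or_ge r j with h2 | h2
      · rw [hS.1 r j (by omega), mul_zero]
      · rw [hi r j (by omega) (by omega), mul_zero]
  rw [← h1, h, h2]

end Conjugation

/-! ### Normalisation over the ground field -/

section Normalisation

variable {K : Type*} [Field K] [CharZero K] {X Y S P Q : DSym K} {d p q N : ℕ}

/-- The matrix form of the vanishing conditions on the diagonals `p - 1, …, p - N`: on the
diagonal `p - i` the entry in a row `a` is zero whenever the residue of `a + p` modulo `q` is at
least `max i d`. -/
def NormalizedUpTo (d p q N : ℕ) (X : DSym K) : Prop :=
  ∀ i a j : ℕ, 0 < i → i ≤ N → a + p = j + i → max i d ≤ (a + p) % q → mat X a j = 0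

/-- Two normalised elements of the centraliser are not conjugate by a non-trivial unitriangular
element vanishing at the residues `0, …, d - 1`. -/
theorem eq_one_of_conj [NeZero q] (hT : ∀ b : ZMod q, ∃ k : ℕ, (b - k * (p : ZMod q)).val < d)
    (hX : Leads X p) (hY : Leads Y p) (hS : Leads S 0) (hSc : S ∈ centr K q)
    (hXn : NormalizedUpTo d p q (q - 1) X) (hYn : NormalizedUpTo d p q (q - 1) Y)
    (hSd : ∀ a j, j < a → a % q < d → mat S a j = 0) (h : S * X = Y * S) : S = 1 := by
  have hq : 0 < q := NeZero.pos q
  have key : ∀ i a j, 0 < i → a = j + i → mat S a j = 0 := by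
    intro i
    induction i using Nat.strong_induction_on with
    | _ i ih =>
      intro a j hi0 haj
      by_cases hiq : q ≤ i
      · exact mat_eq_zero_of_mod_lt hSc (by have := Nat.mod_lt a hq; omega)
      have hlow : ∀ a j, j < a → a < j + i → mat S a j = 0 := fun a j h1 h2 =>
        ih (a - j) (by omega) a j (by omega) (by omega)
      obtain ⟨c, hc, -⟩ := exists_diag hSc
      suffices hs : c (-(i : ℤ)) = 0 by
        rw [hc, show (j : ℤ) - a = -(i : ℤ) by omega, hs]
        rfl
      refine eq_zero_of_shift (T := {b | max i d ≤ b.val}) (p := (p : ZMod q))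
        (fun b => ?_) (fun b hb => ?_) (fun b hb => ?_)
      · obtain ⟨k, hk⟩ := hT b
        exact ⟨k, fun hk' => by
          have : max i d ≤ (b - k * (p : ZMod q)).val := hk'
          omega⟩
      · have hb' : b.val < max i d := not_le.mp hb
        have hmod : (b.val + q) % q = b.val := by
          rw [Nat.add_mod_right, Nat.mod_eq_of_lt (ZMod.val_lt b)]
        rw [diag_eq hc (a := b.val + q) (j := b.val + q - i) (by simp)
          (by push_cast [show i ≤ b.val + q by omega]; ring)]
        rcases lt_or_ge b.val d with hd | hd
        · exact hSd _ _ (by omega) (by omega)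
        · exact mat_eq_zero_of_mod_lt hSc (by omega)
      · -- The row representing `b - p` is taken at least `q`, so that its diagonals `-i` and
        -- `p - i` do exist; `i < q`.
        set a := (b - (p : ZMod q)).val + q with ha
        have hab : ((a + p : ℕ) : ZMod q) = b := by simp [ha]
        have hb' : max i d ≤ (a + p) % q := by
          rw [← ZMod.val_natCast, hab]
          exact hb
        have hl := mat_add_eq_of_conj hX hY hS hi0 hlow h (a := a) (j := a + p - i) (by omega)
        rw [hXn i a _ hi0 (by omega) (by omega) hb', hYn i a _ hi0 (by omega) (by omega) hb',
          if_pos (by omega), zero_add, zero_add] at hl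
        rw [diag_eq hc (a := a + p) (j := a + p - i) hab
          (by push_cast [show i ≤ a + p by omega]; ring),
          diag_eq hc (a := a) (j := a - i) (by simp [ha])
          (by push_cast [show i ≤ a by omega]; ring), hl]
  refine mat_injective fun a j => ?_
  rw [mat_one]
  rcases lt_trichotomy a j with haj | rfl | haj
  · rw [hS.1 a j haj, if_neg haj.ne]
  · rw [if_pos rfl]
    exact hS.2 a
  · rw [key (a - j) a j (by omega) (by omega), if_neg haj.ne']

/-- One step of the normalisation: conjugation by some `1 + s ∫ⁱ` in the centraliser normalises
the diagonal `p - i` and does not change the previous ones. -/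
theorem NormalizedUpTo.exists_step [NeZero q]
    (hT : ∀ b : ZMod q, ∃ k : ℕ, (b - k * (p : ZMod q)).val < d) (hX : Leads X p)
    (hXc : X ∈ centr K q) (hXn : NormalizedUpTo d p q N X) :
    ∃ U : (DSym K)ˣ, (U : DSym K) ∈ centr K q ∧ Leads (U : DSym K) 0 ∧
      Leads (↑U⁻¹ : DSym K) 0 ∧ NormalizedUpTo d p q (N + 1) ((U : DSym K) * X * (↑U⁻¹ : DSym K)) := by
  obtain ⟨c, hc, -⟩ := exists_diag hXc
  set i := N + 1 with hi
  -- The condition on the row `a` is indexed by the residue `b` of `a + p`.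
  obtain ⟨s, hs0, hs⟩ := exists_shift_sub_eq (T := {b : ZMod q | max i d ≤ b.val})
    (p := (p : ZMod q)) (fun b => by
      obtain ⟨k, hk⟩ := hT b
      exact ⟨k, fun hk' => by
        have : max i d ≤ (b - k * (p : ZMod q)).val := hk'
        omega⟩) fun b => c ((p : ℤ) - i) (b - (p : ZMod q))
  have hs0' : ∀ b : ZMod q, b.val < i → s b = 0 := fun b hb => hs0 b fun hb' => by
    have : max i d ≤ b.val := hb'
    omega
  obtain ⟨V, -, hV⟩ := exists_mat_eq (fun a j => if a = j then 1 else if a = j + i then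
    s (a : ZMod q) else 0) 0 fun a j h => by rw [if_neg (by omega), if_neg (by omega)]
  have hVl : Leads V 0 := ⟨fun a j h => by rw [hV, if_neg (by omega), if_neg (by omega)],
    fun a => by rw [hV, if_pos (add_zero a).symm]⟩
  have hVc : V ∈ centr K q := by
    refine mem_centr_of_diag (c := fun l x => if l = 0 then 1 else if l = -(i : ℤ) then s x else 0)
      (fun a j => ?_) fun l x hl => ?_
    · rw [hV]
      congr 1
      · exact propext ⟨by omega, by omega⟩
      · congr 1
        exact propext ⟨by omega, by omega⟩
    · rw [if_neg (by omega)]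
      split_ifs with h
      · exact hs0' x (by omega)
      · rfl
  obtain ⟨U, rfl, hU⟩ := hVl.exists_unit
  refine ⟨U, hVc, hVl, hU, ?_⟩
  set Y := (U : DSym K) * X * (↑U⁻¹ : DSym K) with hYdef
  have hY : Leads Y p := by simpa using (hVl.mul hX).mul hU
  have hconj : (U : DSym K) * X = Y * U := by rw [hYdef, Units.inv_mul_cancel_right]
  have hlow : ∀ a j, j < a → a < j + i → mat (U : DSym K) a j = 0 := fun a j h1 h2 => by
    rw [hV, if_neg (by omega), if_neg (by omega)]
  intro k a j hk0 hk haj hmax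
  rcases Nat.lt_or_ge k i with hki | hki
  · rw [← mat_eq_of_conj hX hY hVl hlow hconj hki haj]
    exact hXn k a j hk0 (by omega) haj hmax
  · obtain rfl : k = i := by omega
    have hl := mat_add_eq_of_conj hX hY hVl hk0 hlow hconj haj
    have h1 : (if i ≤ a then mat (U : DSym K) a (a - i) else 0) = s (a : ZMod q) := by
      split_ifs with hia
      · rw [hV, if_neg (by omega), if_pos (by omega)]
      · refine (hs0' _ ?_).symm
        rw [ZMod.val_natCast]
        have := Nat.mod_le a q
        omega
    have h2 : mat (U : DSym K) (a + p) j = s ((a + p : ℕ) : ZMod q) := by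
      rw [hV, if_neg (by omega), if_pos haj]
    have h3 := hs ((a + p : ℕ) : ZMod q) (by
      change max i d ≤ ((a + p : ℕ) : ZMod q).val
      rwa [ZMod.val_natCast])
    rw [Nat.cast_add, add_sub_cancel_right, ← Nat.cast_add, diag_eq hc rfl (by omega : (j : ℤ) - a = p - i)]
      at h3
    rw [h1, h2, ← h3] at hl
    linear_combination -hl

theorem conj_mem_centr {S : (DSym K)ˣ} (hSQ : (S : DSym K) * Q * (↑S⁻¹ : DSym K) = del K ^ q)
    (hPQ : P * Q = Q * P) : (S : DSym K) * P * (↑S⁻¹ : DSym K) ∈ centr K q := by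
  unfold centr
  rw [Subring.mem_centralizer_iff]
  rintro g rfl
  rw [← hSQ]
  simp only [mul_assoc, Units.inv_mul_cancel_left]
  rw [← mul_assoc Q, ← hPQ, mul_assoc]

/-- Commuting `P`, `Q` can be conjugated simultaneously so that `Q` becomes `∂^q` and `P` becomes
normalised. -/
theorem exists_normalized [NeZero q]
    (hT : ∀ b : ZMod q, ∃ k : ℕ, (b - k * (p : ZMod q)).val < d) (hP : Leads P p)
    (hQ : Leads Q q) (hPQ : P * Q = Q * P) :
    ∃ X : DSym K, IsNormalForm P Q q X ∧ Leads X p ∧ X ∈ centr K q ∧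
      NormalizedUpTo d p q (q - 1) X := by
  have key : ∀ N, N < q → ∃ S : (DSym K)ˣ, Leads (S : DSym K) 0 ∧ Leads (↑S⁻¹ : DSym K) 0 ∧
      (S : DSym K) * Q * (↑S⁻¹ : DSym K) = del K ^ q ∧
      NormalizedUpTo d p q N ((S : DSym K) * P * (↑S⁻¹ : DSym K)) := by
    intro N
    induction N with
    | zero =>
      intro _
      obtain ⟨S, hS, hSQ⟩ := hQ.exists_schur (NeZero.pos q)
      obtain ⟨U, rfl, hU⟩ := hS.exists_unit
      exact ⟨U, hS, hU, by rw [hSQ, Units.mul_inv_cancel_right], fun i a j h1 h2 => by omega⟩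
    | succ N ih =>
      intro hN
      obtain ⟨S, hS, hS', hSQ, hn⟩ := ih (by omega)
      obtain ⟨U, hUc, hU, hU', hUn⟩ := hn.exists_step hT (by simpa using (hS.mul hP).mul hS')
        (conj_mem_centr hSQ hPQ)
      refine ⟨U * S, by simpa using hU.mul hS, by simpa using hS'.mul hU', ?_, ?_⟩
      · have : (U : DSym K) * del K ^ q = del K ^ q * U := by
          unfold centr at hUc
          rw [Subring.mem_centralizer_iff] at hUc
          exact (hUc _ rfl).symm
        rw [mul_inv_rev, Units.val_mul, Units.val_mul]
        calc _ = (U : DSym K) * ((S : DSym K) * Q * (↑S⁻¹ : DSym K)) * (↑U⁻¹ : DSym K) := by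
              simp only [mul_assoc]
          _ = _ := by rw [hSQ, this, Units.mul_inv_cancel_right]
      · rw [mul_inv_rev, Units.val_mul, Units.val_mul]
        simpa only [mul_assoc] using hUn
  obtain ⟨S, hS, hS', hSQ, hn⟩ := key (q - 1) (by have := NeZero.pos q; omega)
  exact ⟨_, ⟨S, hS.isMonic, hSQ, rfl⟩, by simpa using (hS.mul hP).mul hS',
    conj_mem_centr hSQ hPQ, hn⟩

end Normalisation

/-! ### Vector forms and matrices -/

section VectorForm

variable {L : Type*} [Field L] {q : ℕ} {ξ : L}

theorem Phi_zero : Phi q ξ 0 = 0 := by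
  funext j
  simp [Phi]

/-- `Φ` is surjective, by the Vandermonde determinant. -/
theorem Phi_surjective [NeZero q] (hξ : IsPrimitiveRoot ξ q) :
    Function.Surjective (Phi q ξ) := by
  intro v
  have hdet : IsUnit (Matrix.vandermonde fun j : Fin q => ξ ^ (j : ℕ)).det := by
    rw [isUnit_iff_ne_zero, Matrix.det_vandermonde_ne_zero_iff]
    intro a b hab
    exact Fin.ext (hξ.pow_inj a.2 b.2 hab)
  obtain ⟨f, hf⟩ := Matrix.mulVec_surjective_iff_isUnit.mpr
    ((Matrix.isUnit_iff_isUnit_det _).mpr hdet) fun j : Fin q => v ((j : ℕ) : ZMod q)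
  refine ⟨f, funext fun j => ?_⟩
  have h := congrFun hf ⟨j.val, ZMod.val_lt j⟩
  simp only [ZMod.natCast_val, ZMod.cast_id] at h
  rw [← h]
  simp only [Phi, Matrix.mulVec, dotProduct, Matrix.vandermonde_apply]
  exact Finset.sum_congr rfl fun i _ => by ring

variable {K : Type*} [Field K] [CharZero K] [CharZero L] [Algebra K L]

theorem mat_sum_polyA_mul_opD (hξ : ξ ^ q = 1) (f : ℤ →₀ (Fin q → L)) (a j : ℕ) :
    mat (f.sum fun l g => polyA q ξ g * opD L l) a j = Phi q ξ (f ((j : ℤ) - a)) (a : ZMod q) := by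
  unfold Finsupp.sum
  rw [mat_sum, Finset.sum_eq_single ((j : ℤ) - a)]
  · rw [mat_polyA_mul hξ, mat_opD, if_pos rfl, mul_one]
  · intro l _ hl
    rw [mat_polyA_mul hξ, mat_opD, if_neg hl.symm, mul_zero]
  · intro h
    rw [Finsupp.notMem_support_iff] at h
    rw [h, mat_polyA_mul hξ, Phi_zero, Pi.zero_apply, zero_mul]

/-- The coefficients of `Φ̂(P)` are the diagonals of the matrix of `P`. -/
theorem IsPhiHat.algebraMap_mat (hξ : ξ ^ q = 1) {P : DSym K} {c : ℤ → ZMod q → L}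
    (h : IsPhiHat q ξ P c) (a j : ℕ) :
    algebraMap K L (mat P a j) = c ((j : ℤ) - a) (a : ZMod q) := by
  obtain ⟨f, hf, hc⟩ := h
  rw [← mat_baseChange, hf, mat_sum_polyA_mul_opD hξ, hc]

theorem isPhiHat_of_mat [NeZero q] (hξ : IsPrimitiveRoot ξ q) {P : DSym K} {c : ℤ → ZMod q → L}
    (h : ∀ a j : ℕ, algebraMap K L (mat P a j) = c ((j : ℤ) - a) (a : ZMod q)) (s : Finset ℤ)
    (hs : ∀ l ∉ s, c l = 0) : IsPhiHat q ξ P c := by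
  classical
  choose g hg using Phi_surjective hξ
  let f : ℤ →₀ (Fin q → L) := Finsupp.onFinset s (fun l => if c l = 0 then 0 else g (c l))
    fun l hl => by
      by_contra hls
      exact hl (if_pos (hs l hls))
  have hf : ∀ l, c l = Phi q ξ (f l) := fun l => by
    rw [Finsupp.onFinset_apply]
    split_ifs with h0
    · rw [h0, Phi_zero]
    · rw [hg]
  refine ⟨f, mat_injective fun a j => ?_, hf⟩
  rw [mat_baseChange, h, mat_sum_polyA_mul_opD hξ.pow_eq_one, hf]

end VectorForm

/-! ### Partially normalised operators -/

section PartiallyNormalized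

variable {K L : Type*} [Field K] [CharZero K] [Field L] [CharZero L] [Algebra K L] {d m n : ℕ}
  {ξ : L} {P : DSym K} {c : ℤ → ZMod (d * m) → L}

theorem IsPartiallyNormalized.leads (hξ : ξ ^ (d * m) = 1)
    (h : IsPartiallyNormalized d m n ξ P c) : Leads P (d * n) := by
  obtain ⟨-, hp, h1, h0, -⟩ := h
  refine ⟨fun a j haj => ?_, fun a => ?_⟩ <;> apply FaithfulSMul.algebraMap_injective K L
  · rw [hp.algebraMap_mat hξ, h0 _ (Or.inr (by omega)), map_zero]
    rfl
  · rw [hp.algebraMap_mat hξ, show ((a + d * n : ℕ) : ℤ) - a = (d * n : ℕ) by push_cast; ring, h1,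
      map_one]
    rfl

theorem IsPartiallyNormalized.normalizedUpTo (hd : 0 < d) (hm : 0 < m) (hnm : Nat.Coprime n m)
    (hξ : ξ ^ (d * m) = 1) (h : IsPartiallyNormalized d m n ξ P c) :
    NormalizedUpTo d (d * n) (d * m) (d * m - 1) P := by
  obtain ⟨-, hp, -, -, h0⟩ := h
  intro i a j hi0 hi haj hmax
  have hq : 0 < d * m := Nat.mul_pos hd hm
  apply FaithfulSMul.algebraMap_injective K L
  rw [hp.algebraMap_mat hξ, map_zero]
  apply h0
  have hF : FirstRule d m n ((j : ℤ) - a) (a : ZMod (d * m)) := by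
    refine firstRule_of_le hd hm hnm ?_
    rw [← Nat.cast_add, ZMod.val_natCast]
    omega
  refine ⟨by omega, by omega, ?_⟩
  rcases le_or_gt (d * m) (d * n) with h1 | h1
  · exact Or.inl ⟨h1, Or.inl ⟨by omega, hF⟩⟩
  · refine Or.inr ⟨h1, ?_⟩
    rcases le_or_gt 0 ((j : ℤ) - a) with h2 | h2
    · exact Or.inl ⟨h2, hF⟩
    · exact Or.inr (Or.inl ⟨by omega, h2, Or.inr hF⟩)

theorem IsPartiallyNormalized.coeff_unique {c' : ℤ → ZMod (d * m) → L} (hq : 0 < d * m)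
    (hξ : ξ ^ (d * m) = 1) (h : IsPartiallyNormalized d m n ξ P c)
    (h' : IsPartiallyNormalized d m n ξ P c') : c = c' := by
  have : NeZero (d * m) := ⟨hq.ne'⟩
  obtain ⟨-, hp, -, h0, -⟩ := h
  obtain ⟨-, hp', -, h0', -⟩ := h'
  funext l x
  by_cases hl : l ≤ -((d * m : ℕ) : ℤ)
  · rw [h0 l (Or.inl hl), h0' l (Or.inl hl)]
  · have ha : ((x.val + d * m : ℕ) : ZMod (d * m)) = x := by
      rw [Nat.cast_add, ZMod.natCast_self, add_zero, ZMod.natCast_val, ZMod.cast_id]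
    have hj : ((((x.val + d * m : ℕ) + l).toNat : ℕ) : ℤ) - (x.val + d * m : ℕ) = l := by omega
    rw [diag_eq (hp.algebraMap_mat hξ) ha hj, diag_eq (hp'.algebraMap_mat hξ) ha hj]

theorem exists_isPartiallyNormalized (hd : 0 < d) (hm : 0 < m)
    (hξ : IsPrimitiveRoot ξ (d * m)) (hP : Leads P (d * n)) (hPc : P ∈ centr K (d * m))
    (hPn : NormalizedUpTo d (d * n) (d * m) (d * m - 1) P) :
    ∃ c : ℤ → ZMod (d * m) → L, IsPartiallyNormalized d m n ξ P c := by
  have hq : 0 < d * m := Nat.mul_pos hd hm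
  have : NeZero (d * m) := ⟨hq.ne'⟩
  obtain ⟨c, hc, hlow⟩ := exists_diag hPc
  have ha : ∀ x : ZMod (d * m), ((x.val + d * m : ℕ) : ZMod (d * m)) = x := fun x => by
    rw [Nat.cast_add, ZMod.natCast_self, add_zero, ZMod.natCast_val, ZMod.cast_id]
  have hval : ∀ (l : ℤ) (x : ZMod (d * m)), -((d * m : ℕ) : ℤ) < l →
      c l x = mat P (x.val + d * m) ((x.val + d * m : ℕ) + l).toNat := fun l x hl =>
    diag_eq hc (ha x) (by omega)
  have hup : ∀ l, ((d * n : ℕ) : ℤ) < l → c l = 0 := fun l hl => funext fun x => by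
    rw [hval l x (by omega), hP.1 _ _ (by omega)]
    rfl
  have hout : ∀ l : ℤ, (l ≤ -((d * m : ℕ) : ℤ) ∨ ((d * n : ℕ) : ℤ) < l) → c l = 0 :=
    fun l hl => hl.elim (hlow l) (hup l)
  have hF : ∀ l x, ((d * n : ℕ) : ℤ) - (d * m : ℕ) < l → -((d * m : ℕ) : ℤ) < l →
      l < (d * n : ℕ) → FirstRule d m n l x → c l x = 0 := by
    intro l x h1 h2 h3 h4
    have h5 := le_of_firstRule hm h4
    rw [hval l x h2]
    refine hPn (((d * n : ℕ) : ℤ) - l).toNat _ _ (by omega) (by omega) (by omega) ?_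
    have h6 : ((x.val + d * m + d * n) % (d * m)) = (x + ((d * n : ℕ) : ZMod (d * m))).val := by
      rw [← ZMod.val_natCast, Nat.cast_add, ha]
    rw [h6]
    omega
  have hS : ∀ l x, -((d * m : ℕ) : ℤ) < l → SecondRule d m l x → c l x = 0 := by
    rintro l x h1 ⟨t, ht, rfl⟩
    rw [diag_eq hc (a := t + d * m) (j := ((t + d * m : ℕ) + l).toNat) (x := (t : ZMod (d * m)))
      (by rw [Nat.cast_add, ZMod.natCast_self, add_zero]) (by omega)]
    refine mat_eq_zero_of_mod_lt hPc ?_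
    rw [Nat.add_mod_right, Nat.mod_eq_of_lt (by omega)]
    omega
  refine ⟨fun l x => algebraMap K L (c l x), hPc, isPhiHat_of_mat hξ (fun a j => by rw [hc])
    (Finset.Ioc (-((d * m : ℕ) : ℤ)) (d * n : ℕ)) fun l hl => ?_, ?_, fun l hl => ?_, ?_⟩
  · rw [Finset.mem_Ioc, not_and_or, not_lt, not_le] at hl
    funext x
    simp [hout l hl]
  · funext x
    simp only
    rw [hval _ x (by omega), show (((x.val + d * m : ℕ) : ℤ) + (d * n : ℕ)).toNat =
      x.val + d * m + d * n by omega, hP.2, map_one]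
    rfl
  · funext x
    simp [hout l hl]
  · rintro l x ⟨h1, h2, h3⟩
    simp only
    rw [← map_zero (algebraMap K L)]
    congr 1
    rcases h3 with ⟨h3, (⟨h4, h5⟩ | ⟨h4, h5⟩)⟩ | ⟨h3, (⟨h4, h5⟩ | ⟨h4, h6, (h5 | h5)⟩ | ⟨h4, h5⟩)⟩
    · exact hF l x h4 h1 h2 h5
    · exact hS l x h1 h5
    · exact hF l x (by omega) h1 h2 h5
    · exact hS l x h1 h5
    · exact hF l x h4 h1 h2 h5
    · exact hS l x h1 h5

theorem IsAdmissible.mat_eq (hξ : ξ ^ (d * m) = 1) {S : DSym K} (h : IsAdmissible d m ξ S) :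
    Leads S 0 ∧ ∀ a j, j < a → a % (d * m) < d → mat S a j = 0 := by
  obtain ⟨-, s, hs, hs0⟩ := h
  have hm : ∀ a j, algebraMap K L (mat S a j) = (if a = j then 1 else 0) +
      ∑ l ∈ Finset.Icc 1 (d * m - 1), Phi (d * m) ξ (s l) (a : ZMod (d * m)) *
        (if a = j + l then 1 else 0) := fun a j => by
    rw [← mat_baseChange, hs, mat_add, mat_one, mat_sum]
    simp only [mat_polyA_mul hξ, mat_integ_pow]
  have hle : ∀ a j, a ≤ j → algebraMap K L (mat S a j) = if a = j then 1 else 0 := by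
    intro a j haj
    rw [hm, Finset.sum_eq_zero, add_zero]
    intro l hl
    rw [Finset.mem_Icc] at hl
    rw [if_neg (by omega), mul_zero]
  refine ⟨⟨fun a j haj => ?_, fun a => ?_⟩, fun a j haj had => ?_⟩ <;>
    apply FaithfulSMul.algebraMap_injective K L
  · rw [hle a j (by omega), if_neg (by omega), map_zero]
  · rw [hle a _ le_self_add, if_pos (add_zero a).symm, map_one]
  · rw [hm, if_neg (by omega), zero_add, map_zero]
    refine Finset.sum_eq_zero fun l hl => ?_
    have hcast : (a : ZMod (d * m)) = ((a % (d * m) : ℕ) : ZMod (d * m)) :=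
      (ZMod.natCast_mod a (d * m)).symm
    rw [hcast, hs0 l hl _ had, zero_mul]

/-- A conjugation between partially normalised operators as in the last two assertions is
trivial. -/
theorem IsPartiallyNormalized.eq_one_of_conj (hd : 0 < d) (hm : 0 < m) (hnm : Nat.Coprime n m)
    (hξ : ξ ^ (d * m) = 1) {P' P'' : DSym K} {c' c'' : ℤ → ZMod (d * m) → L}
    (h' : IsPartiallyNormalized d m n ξ P' c') (h'' : IsPartiallyNormalized d m n ξ P'' c'')
    {S : (DSym K)ˣ} (hS : IsAdmissible d m ξ (S : DSym K))
    (h : P' = (↑S⁻¹ : DSym K) * P'' * (S : DSym K)) : S = 1 := by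
  have : NeZero (d * m) := ⟨(Nat.mul_pos hd hm).ne'⟩
  obtain ⟨hS1, hS2⟩ := hS.mat_eq hξ
  refine Units.ext (NormalForms.eq_one_of_conj (exists_val_sub_mul_lt hd hm hnm) (h'.leads hξ)
    (h''.leads hξ) hS1 hS.1 (h'.normalizedUpTo hd hm hnm hξ) (h''.normalizedUpTo hd hm hnm hξ)
    hS2 ?_)
  rw [h, mul_assoc, Units.mul_inv_cancel_left]

end PartiallyNormalized

end NormalForms

theorem lemma3p1 {K L : Type*} [Field K] [CharZero K] [Field L] [CharZero L] [Algebra K L]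
    (d m n : ℕ) (hd : 0 < d) (hm : 0 < m) (hn : 0 < n) (hnm : Nat.Coprime n m)
    (ξ : L) (hξ : IsPrimitiveRoot ξ (d * m))
    (P Q : DSym K) (hQ : IsNormalizedDiffOp Q (d * m)) (hP : IsMonicDiffOp P (d * n))
    (hPQ : P * Q = Q * P) :
    (∃ (P' : DSym K) (c : ℤ → ZMod (d * m) → L),
      IsNormalForm P Q (d * m) P' ∧ IsPartiallyNormalized d m n ξ P' c) ∧
    (∀ (P' P'' : DSym K) (c' c'' : ℤ → ZMod (d * m) → L),
      IsPartiallyNormalized d m n ξ P' c' → IsPartiallyNormalized d m n ξ P'' c'' →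
      (∃ l j, IsCoordinate d m n l j ∧ c' l j ≠ c'' l j) →
      ¬ ∃ S : (DSym K)ˣ, IsAdmissible d m ξ (S : DSym K) ∧
        P' = (↑S⁻¹ : DSym K) * P'' * (S : DSym K)) ∧
    (∀ (P' : DSym K) (c' : ℤ → ZMod (d * m) → L),
      IsPartiallyNormalized d m n ξ P' c' →
      ¬ ∃ S : (DSym K)ˣ, S ≠ 1 ∧ IsAdmissible d m ξ (S : DSym K) ∧
        P' = (↑S⁻¹ : DSym K) * P' * (S : DSym K)) := by
  have hq : 0 < d * m := Nat.mul_pos hd hm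
  have : NeZero (d * m) := ⟨hq.ne'⟩
  refine ⟨?_, ?_, ?_⟩
  · obtain ⟨P', hnf, hl, hc, hnorm⟩ := exists_normalized (exists_val_sub_mul_lt hd hm hnm)
      hP.leads hQ.2.1.leads hPQ
    obtain ⟨c, h⟩ := exists_isPartiallyNormalized hd hm hξ hl hc hnorm
    exact ⟨P', c, hnf, h⟩
  · rintro P' P'' c' c'' h' h'' ⟨l, j, -, hne⟩ ⟨S, hS, hconj⟩
    obtain rfl := h'.eq_one_of_conj hd hm hnm hξ.pow_eq_one h'' hS hconj
    obtain rfl : P' = P'' := by simpa using hconj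
    exact hne (by rw [h'.coeff_unique hq hξ.pow_eq_one h''])
  · rintro P' c' h' ⟨S, hS1, hS, hconj⟩
    exact hS1 (h'.eq_one_of_conj hd hm hnm hξ.pow_eq_one h' hS hconj)
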